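/- Consider an update-and-decision M/G/1/1-M bufferless system. Updates are generated according to a Poisson process of rate $\lambda>0$; a server handles one update at a time, and there is no waiting room: an update that arrives while the server is idle (a successful update) enters service immediately, every other update is discarded. The service times of the successful updates are i.i.d., and decisions are made at the epochs $\tau_1<\tau_2<\dots$ of a Poisson process of rate $\nu>0$; arrivals, service times and decisions are mutually independent, and the server is idle at time $0$. If the $k$-th successful update arrives at time $t_k$ and completes its service at time $t_k'$, the age upon the $j$-th decision is $\Delta_{\rm D}(\tau_j)=\tau_j-t_{N(\tau_j)}$ with $N(\tau_j)=\max\{k : t_k'\le\tau_j\}$ (and $\Delta_{\rm D}(\tau_j)=\tau_j$ as long as no update has completed its service). The average age upon decisions (average AuD) is $$\overline{\Delta}_{\rm D}=\lim_{T\to\infty}\frac1{N_T}\sum_{j=1}^{N_T}\Delta_{\rm D}(\tau_j),$$ where $N_T$ is the number of decisions made up to time $T$. Let $\mu>0$ and $\rho=\lambda/\mu$. For service times that are uniform on $(0,2/\mu)$ (M/U/1/1-M), exponential with rate $\mu$ (M/M/1/1-M), or equal to the constant $1/\mu$ (M/D/1/1-M), the limit exists almost surely and is the constant $$\overline{\Delta}_{\rm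 M/U/1/1-M}=\frac{3+6\rho+5\rho^2}{3\lambda(1+\rho)},\qquad \overline{\Delta}_{\rm M/M/1/1-M}=\frac{1+2\rho+2\rho^2}{\lambda(1+\rho)},\qquad \overline{\Delta}_{\rm M/D/1/1-M}=\frac{2+4\rho+3\rho^2}{2\lambda(1+\rho)},$$ respectively, whatever the decision rate $\nu$ is. In particular, for the same $\lambda$ and $\mu$ (the decision rates of the three systems may differ), $$\overline{\Delta}_{\rm M/D/1/1-M}<\overline{\Delta}_{\rm M/U/1/1-M}<\overline{\Delta}_{\rm M/M/1/1-M}.$$ -/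

import Mathlib

open MeasureTheory ProbabilityTheory Filter Topology

noncomputable section

namespace BufferlessQueue

/-! ### Sample paths

All indices start at `0`.  A sample path is given by the inter-arrival times `X`, the service times
`S` of the successful updates, and the inter-decision times `Z`.  The system starts at time `0`
with an idle server. -/

/-- The `n`-th epoch of the point process on `(0, ∞)` with successive gaps
`G 0, G 1, G 2, …`; the first epoch is `G 0`. -/
def epoch (G : ℕ → ℝ) (n : ℕ) : ℝ := ∑ i ∈ Finset.range (n + 1), G i

/-- The position, among all generated updates, of the `k`-th successful update.
The first update finds the server idle; after the `k`-th successful update, the next successful one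
is the first later update that arrives when the service of the `k`-th has been completed.
All updates in between are dropped. -/
def successIndex (X S : ℕ → ℝ) : ℕ → ℕ
  | 0 => 0
  | k + 1 => sInf {n : ℕ | successIndex X S k < n ∧
      epoch X (successIndex X S k) + S k ≤ epoch X n}

/-- The arrival (generation) time `t_k` of the `k`-th successful update. -/
def arrivalTime (X S : ℕ → ℝ) (k : ℕ) : ℝ := epoch X (successIndex X S k)

/-- The time `t_k'` at which the service of the `k`-th successful update is completed. -/
def departureTime (X S : ℕ → ℝ) (k : ℕ) : ℝ := arrivalTime X S k + S k

/-- The index `max {k | t_k' ≤ τ}` of the most recently received update at time `τ`. -/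
def latestReceived (X S : ℕ → ℝ) (τ : ℝ) : ℕ := sSup {k : ℕ | departureTime X S k ≤ τ}

open Classical in
/-- The age at time `τ`: the time elapsed since the generation of the most recently received
update.  As long as nothing has been received, age is counted from time `0`. -/
def age (X S : ℕ → ℝ) (τ : ℝ) : ℝ :=
  if ∃ k, departureTime X S k ≤ τ then τ - arrivalTime X S (latestReceived X S τ) else τ

/-- The age upon the `j`-th decision. -/
def ageUponDecision (X S Z : ℕ → ℝ) (j : ℕ) : ℝ := age X S (epoch Z j)

/-- The number of decisions made up to time `T`. -/
def numDecisions (Z : ℕ → ℝ) (T : ℝ) : ℕ := {j : ℕ | epoch Z j ≤ T}.ncard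

/-- The average of the ages upon the decisions made up to time `T`. -/
def empiricalAuD (X S Z : ℕ → ℝ) (T : ℝ) : ℝ :=
  (1 / (numDecisions Z T : ℝ)) * ∑ j ∈ Finset.range (numDecisions Z T), ageUponDecision X S Z j

/-! ### The random system -/

/-- `X`, `S`, `Z` drive an M/G/1/1-M bufferless system on `(Ω, P)` with arrival rate `lam`, decision
rate `nu` and service time distribution `σ`: the inter-arrival times `X` are exponential with rate
`lam`, the service times `S` have law `σ`, the inter-decision times `Z` are exponential with
rate `nu`, and all of these random variables are jointly independent. -/
structure IsMG11M {Ω : Type*} [MeasurableSpace Ω] (P : Measure Ω) (lam nu : ℝ) (σ : Measure ℝ)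
    (X S Z : ℕ → Ω → ℝ) : Prop where
  law_arrival : ∀ n, HasLaw (X n) (expMeasure lam) P
  law_service : ∀ n, HasLaw (S n) σ P
  law_decision : ∀ n, HasLaw (Z n) (expMeasure nu) P
  indep : iIndepFun (Sum.elim X (Sum.elim S Z)) P

/-- The average AuD of the system is `c`: almost surely, the average of the ages upon the decisions
made up to time `T` converges to `c` as `T → ∞`. -/
def HasAverageAuD {Ω : Type*} [MeasurableSpace Ω] (P : Measure Ω) (X S Z : ℕ → Ω → ℝ)
    (c : ℝ) : Prop :=
  ∀ᵐ ω ∂P, Tendsto (empiricalAuD (fun n => X n ω) (fun n => S n ω) (fun n => Z n ω))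
    atTop (𝓝 c)

/-! ### The service time distributions with mean `1 / mu` -/

/-- The uniform distribution on `(0, 2 / mu)`. -/
def uniformService (mu : ℝ) : Measure ℝ := cond volume (Set.Ioo 0 (2 / mu))

/-- The exponential distribution with rate `mu`. -/
def exponentialService (mu : ℝ) : Measure ℝ := expMeasure mu

/-- The deterministic service time `1 / mu`. -/
def deterministicService (mu : ℝ) : Measure ℝ := Measure.dirac (1 / mu)

end BufferlessQueue

end

/-!
The age process is handled path by path, in three layers of randomness: the service times are fixed
first, then the arrivals, then the decisions.

Each layer rests on the same law of large numbers, `tendsto_average_of_adapted`: if `D n` is a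
function of the first `n + 1` terms of an i.i.d. sequence, has mean zero given the first `n` of
them, and has an eighth moment of order `n`, then the averages of `D` tend to `0` almost surely.
The variables `D n` are orthogonal, so Chebyshev's inequality gives convergence along the squares,
and the variation between consecutive squares is small.

* Arrivals (`ae_averageVanishes`). The state of the server seen by the successive arrivals is a
  Markov chain, `server`. By the memoryless property of the exponential law, the idle time which
  precedes a successful arrival is independent of the past and exponential. Hence the idle times
  `I k` preceding the successful updates average to `1 / lam`, their squares to `2 / lam ^ 2`, and
  they are asymptotically uncorrelated with the service times.
* Time average (`IsTypical.tendsto_time_average`). The `k`-th cycle consists of the `k`-th idle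
  period and the service `S k` that follows. The age starts it at `S (k - 1)` and grows at unit
  speed, so its integral over the cycle is `S (k - 1) * U + U ^ 2 / 2` with `U = I k + S k`.
  Dividing the average integral by the average cycle length gives the long-run time average
  `m + E[U ^ 2] / (2 * E[U])`, where `m` is the mean service time.
* Decisions (`ae_tendsto_poisson_average`). For a fixed, slowly growing age function `f`, the value
  of `f` at a Poisson epoch minus `nu` times the integral of `f` since the previous epoch has
  conditional mean zero. Hence the average upon decisions is the time average, whatever `nu` is.

The layers are put together by Fubini's theorem on the space of paths, for which the age is shown
to be jointly measurable. The result, `IsMG11M.hasAverageAuD`, only involves the first two moments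
of the service time. The means agree in the three systems, so the averages are ordered like the
second moments: `1 / mu ^ 2` (constant), `4 / (3 * mu ^ 2)` (uniform), `2 / mu ^ 2` (exponential).
-/

noncomputable section

namespace BufferlessQueue

/-! ### A law of large numbers for orthogonal increments -/

/-- Young-type bound: small values of `x ^ 2` are below `q`, large ones are controlled by `x ^ 8`. -/
lemma sq_le_add_pow_eight_div (x : ℝ) {q : ℝ} (hq : 0 < q) : x ^ 2 ≤ q + x ^ 8 / q ^ 3 := by
  rcases le_or_gt (x ^ 2) q with h | h
  · have : 0 ≤ x ^ 8 / q ^ 3 := by positivity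
    linarith
  · have h1 : q ^ 3 ≤ (x ^ 2) ^ 3 := by gcongr
    have h2 : x ^ 2 ≤ x ^ 8 / q ^ 3 := by
      rw [le_div_iff₀ (by positivity)]
      calc x ^ 2 * q ^ 3 ≤ x ^ 2 * (x ^ 2) ^ 3 := by gcongr
        _ = x ^ 8 := by ring
    linarith

lemma integrable_sq_of_pow_eight {Ω : Type*} [MeasurableSpace Ω] {P : Measure Ω}
    [IsFiniteMeasure P] {f : Ω → ℝ} (hf : AEStronglyMeasurable f P)
    (h : Integrable (fun ω => f ω ^ 8) P) : Integrable (fun ω => f ω ^ 2) P := by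
  refine Integrable.mono' ((integrable_const (1 : ℝ)).add h) (hf.pow 2) (ae_of_all _ fun ω => ?_)
  have := sq_le_add_pow_eight_div (f ω) one_pos
  rw [Real.norm_of_nonneg (by positivity)]
  simpa using this

/-- Nonnegative random variables whose expectations are summable tend to `0` almost surely. -/
lemma ae_tendsto_zero_of_summable_integral {Ω : Type*} [MeasurableSpace Ω] {P : Measure Ω}
    {Y : ℕ → Ω → ℝ} (hint : ∀ n, Integrable (Y n) P) (hnn : ∀ n ω, 0 ≤ Y n ω)
    {b : ℕ → ℝ} (hb : Summable b) (hle : ∀ n, ∫ ω, Y n ω ∂P ≤ b n) :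
    ∀ᵐ ω ∂P, Tendsto (fun n => Y n ω) atTop (𝓝 0) := by
  have hb0 : ∀ n, 0 ≤ b n := fun n => (integral_nonneg (hnn n)).trans (hle n)
  have h1 : ∫⁻ ω, ∑' n, ENNReal.ofReal (Y n ω) ∂P ≠ ⊤ := by
    rw [lintegral_tsum fun n => (hint n).1.aemeasurable.ennreal_ofReal]
    refine ne_top_of_le_ne_top (b := ∑' n, ENNReal.ofReal (b n)) ?_ ?_
    · rw [← ENNReal.ofReal_tsum_of_nonneg hb0 hb]
      exact ENNReal.ofReal_ne_top
    · refine ENNReal.tsum_le_tsum fun n => ?_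
      rw [← ofReal_integral_eq_lintegral_ofReal (hint n) (ae_of_all _ (hnn n))]
      exact ENNReal.ofReal_le_ofReal (hle n)
  have h2 := ae_lt_top' (AEMeasurable.tsum
    fun n => (hint n).1.aemeasurable.ennreal_ofReal) h1
  filter_upwards [h2] with ω hω
  have h3 := ENNReal.tendsto_atTop_zero_of_tsum_ne_top hω.ne
  have h4 := (ENNReal.tendsto_toReal ENNReal.zero_ne_top).comp h3
  simpa [Function.comp_def, ENNReal.toReal_ofReal (hnn _ ω)] using h4

/-- The deterministic interpolation step: it suffices to control the partial sums along the squares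
and the absolute variation between consecutive squares. -/
lemma tendsto_average_of_squares {d : ℕ → ℝ}
    (h1 : Tendsto (fun m : ℕ => (∑ i ∈ Finset.range (m ^ 2), d i) ^ 2 / (m : ℝ) ^ 4) atTop (𝓝 0))
    (h2 : Tendsto (fun m : ℕ => (∑ i ∈ Finset.Ico (m ^ 2) ((m + 1) ^ 2), |d i|) ^ 2 / (m : ℝ) ^ 4)
      atTop (𝓝 0)) :
    Tendsto (fun n : ℕ => (∑ i ∈ Finset.range n, d i) / n) atTop (𝓝 0) := by
  have hs : Tendsto Nat.sqrt atTop atTop := by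
    refine tendsto_atTop.2 fun b => ?_
    filter_upwards [eventually_ge_atTop (b * b)] with n hn
    exact Nat.le_sqrt.2 hn
  have h3 : Tendsto (fun n : ℕ => (∑ i ∈ Finset.range n, d i) ^ 2 / (n : ℝ) ^ 2) atTop (𝓝 0) := by
    have h4 := ((h1.add h2).const_mul 2).comp hs
    simp only [add_zero, mul_zero] at h4
    refine squeeze_zero (fun n => by positivity) (fun n => ?_) h4
    rcases Nat.eq_zero_or_pos n with rfl | hn
    · simp
    set m := Nat.sqrt n with hm
    have hmn : m ^ 2 ≤ n := by rw [pow_two]; exact Nat.sqrt_le n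
    have hnm : n ≤ (m + 1) ^ 2 := by rw [pow_two]; exact (Nat.lt_succ_sqrt n).le
    have hm0 : 0 < m := Nat.sqrt_pos.2 hn
    have e : ∑ i ∈ Finset.range n, d i
        = ∑ i ∈ Finset.range (m ^ 2), d i + ∑ i ∈ Finset.Ico (m ^ 2) n, d i := by
      rw [Finset.sum_range_add_sum_Ico _ hmn]
    have e2 : |∑ i ∈ Finset.Ico (m ^ 2) n, d i|
        ≤ ∑ i ∈ Finset.Ico (m ^ 2) ((m + 1) ^ 2), |d i| := by
      refine (Finset.abs_sum_le_sum_abs _ _).trans ?_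
      exact Finset.sum_le_sum_of_subset_of_nonneg (Finset.Ico_subset_Ico_right hnm)
        fun i _ _ => abs_nonneg _
    have e3 : (∑ i ∈ Finset.Ico (m ^ 2) n, d i) ^ 2
        ≤ (∑ i ∈ Finset.Ico (m ^ 2) ((m + 1) ^ 2), |d i|) ^ 2 := by
      rw [← sq_abs (∑ i ∈ Finset.Ico (m ^ 2) n, d i)]; gcongr
    have e4 : ((m : ℝ)) ^ 4 ≤ (n : ℝ) ^ 2 := by
      have : ((m ^ 2 : ℕ) : ℝ) ≤ n := by exact_mod_cast hmn
      calc (m : ℝ) ^ 4 = ((m ^ 2 : ℕ) : ℝ) ^ 2 := by push_cast; ring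
        _ ≤ (n : ℝ) ^ 2 := by gcongr
    have hm' : (0 : ℝ) < m := by exact_mod_cast hm0
    simp only [Function.comp_apply, ← hm]
    rw [← add_div, ← mul_div_assoc]
    refine div_le_div₀ (by positivity) ?_ (by positivity) e4
    rw [e]
    nlinarith [sq_nonneg (∑ i ∈ Finset.range (m ^ 2), d i - ∑ i ∈ Finset.Ico (m ^ 2) n, d i)]
  have h5 := (Real.continuous_sqrt.tendsto 0).comp h3
  simp only [Real.sqrt_zero, Function.comp_def, ← div_pow, Real.sqrt_sq_eq_abs] at h5
  exact (tendsto_zero_iff_abs_tendsto_zero _).2 h5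

lemma sum_sq_eq_of_orthogonal {Ω : Type*} [MeasurableSpace Ω] {P : Measure Ω}
    {D : ℕ → Ω → ℝ} (hL2 : ∀ n, MemLp (D n) 2 P)
    (horth : ∀ i j, i < j → ∫ ω, D i ω * D j ω ∂P = 0) (n : ℕ) :
    ∫ ω, (∑ i ∈ Finset.range n, D i ω) ^ 2 ∂P = ∑ i ∈ Finset.range n, ∫ ω, D i ω ^ 2 ∂P := by
  induction n with
  | zero => simp
  | succ n ih =>
    have hS : MemLp (fun ω => ∑ i ∈ Finset.range n, D i ω) 2 P := memLp_finsetSum _ fun i _ => hL2 i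
    have hc : ∫ ω, (∑ i ∈ Finset.range n, D i ω) * D n ω ∂P = 0 := by
      simp_rw [Finset.sum_mul]
      rw [integral_finsetSum _ fun i _ => show Integrable (fun ω => D i ω * D n ω) P from
        (hL2 i).integrable_mul (hL2 n)]
      exact Finset.sum_eq_zero fun i hi => horth i n (Finset.mem_range.1 hi)
    have hi : Integrable (fun ω => (∑ i ∈ Finset.range n, D i ω) * D n ω) P :=
      hS.integrable_mul (hL2 n)
    rw [Finset.sum_range_succ, ← ih]
    simp_rw [Finset.sum_range_succ]
    have e : ∀ ω, (∑ i ∈ Finset.range n, D i ω + D n ω) ^ 2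
        = (∑ i ∈ Finset.range n, D i ω) ^ 2 + D n ω ^ 2
          + 2 * ((∑ i ∈ Finset.range n, D i ω) * D n ω) := fun ω => by ring
    simp_rw [e]
    rw [integral_add (show Integrable (fun ω => (∑ i ∈ Finset.range n, D i ω) ^ 2 + D n ω ^ 2) P
        from hS.integrable_sq.add (hL2 n).integrable_sq) (hi.const_mul 2),
      integral_add hS.integrable_sq (hL2 n).integrable_sq, integral_const_mul, hc]
    ring

/-- A strong law of large numbers for pairwise orthogonal variables whose eighth moments grow at
most linearly.  The second moments of the first `m ^ 2` variables are then of order `√m`; both the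
partial sum up to `m ^ 2` and the variation up to `(m + 1) ^ 2`, divided by `m ^ 2`, have second
moments of order `m ^ (-3 / 2)`, which is summable. -/
theorem tendsto_average_of_orthogonal {Ω : Type*} [MeasurableSpace Ω] {P : Measure Ω}
    [IsProbabilityMeasure P] {D : ℕ → Ω → ℝ} {C : ℝ} (hmeas : ∀ n, AEStronglyMeasurable (D n) P)
    (hint : ∀ n, Integrable (fun ω => D n ω ^ 8) P)
    (hmom : ∀ n, ∫ ω, D n ω ^ 8 ∂P ≤ C * (n + 1))
    (horth : ∀ i j, i < j → ∫ ω, D i ω * D j ω ∂P = 0) :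
    ∀ᵐ ω ∂P, Tendsto (fun n : ℕ => (∑ i ∈ Finset.range n, D i ω) / n) atTop (𝓝 0) := by
  have hL2 : ∀ n, MemLp (D n) 2 P := fun n =>
    (memLp_two_iff_integrable_sq (hmeas n)).2 (integrable_sq_of_pow_eight (hmeas n) (hint n))
  have hC : 0 ≤ C := by
    have h := hmom 0
    have h' : 0 ≤ ∫ ω, D 0 ω ^ 8 ∂P := integral_nonneg fun ω => by positivity
    simp at h; linarith
  -- choosing the threshold `√(m + 1)` in the Young-type bound, second moments in the block before `(m + 1) ^ 2` are of order `√m`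
  have hsq : ∀ m n : ℕ, n < (m + 1) ^ 2 → ∫ ω, D n ω ^ 2 ∂P ≤ (1 + C) * √(m + 1 : ℝ) := by
    intro m n hn
    set q := √(m + 1 : ℝ) with hqdef
    have hq : 0 < q := Real.sqrt_pos.2 (by positivity)
    have hqq : q ^ 2 = m + 1 := Real.sq_sqrt (by positivity)
    have hn' : (n : ℝ) + 1 ≤ q ^ 4 := by
      have : ((n + 1 : ℕ) : ℝ) ≤ ((m + 1) ^ 2 : ℕ) := by exact_mod_cast hn
      push_cast at this
      calc (n : ℝ) + 1 ≤ (m + 1 : ℝ) ^ 2 := this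
        _ = q ^ 4 := by rw [← hqq]; ring
    calc ∫ ω, D n ω ^ 2 ∂P ≤ ∫ ω, (q + D n ω ^ 8 / q ^ 3) ∂P :=
          integral_mono (hL2 n).integrable_sq ((integrable_const _).add ((hint n).div_const _))
            fun ω => sq_le_add_pow_eight_div _ hq
      _ = q + (∫ ω, D n ω ^ 8 ∂P) / q ^ 3 := by
          rw [integral_add (integrable_const _) ((hint n).div_const _), integral_div]; simp
      _ ≤ q + (C * q ^ 4) / q ^ 3 := by
          gcongr
          exact (hmom n).trans (by gcongr)
      _ = (1 + C) * q := by field_simp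
  have hsum : Summable fun m : ℕ => (20 * (1 + C)) * (1 / (m : ℝ) ^ (3 / 2 : ℝ)) :=
    (Real.summable_one_div_nat_rpow.2 (by norm_num)).mul_left _
  have hpow : ∀ m : ℕ, (m : ℝ) ^ 2 * √(m + 1 : ℝ) / (m : ℝ) ^ 4 ≤ 2 * (1 / (m : ℝ) ^ (3 / 2 : ℝ)) := by
    intro m
    rcases Nat.eq_zero_or_pos m with rfl | hm
    · simp
    have hm' : (1 : ℝ) ≤ m := by exact_mod_cast hm
    have h0 : (0 : ℝ) < m := by linarith
    have h1 : √(m + 1 : ℝ) ≤ 2 * √(m : ℝ) := by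
      rw [Real.sqrt_le_left (by positivity), mul_pow, Real.sq_sqrt h0.le]; linarith
    have h2 : (m : ℝ) ^ (3 / 2 : ℝ) = m * √(m : ℝ) := by
      rw [Real.sqrt_eq_rpow, ← Real.rpow_one_add' h0.le (by norm_num)]; norm_num
    have hs : 0 < √(m : ℝ) := Real.sqrt_pos.2 h0
    have hss : √(m : ℝ) ^ 2 = m := Real.sq_sqrt h0.le
    calc (m : ℝ) ^ 2 * √(m + 1 : ℝ) / (m : ℝ) ^ 4 ≤ (m : ℝ) ^ 2 * (2 * √(m : ℝ)) / (m : ℝ) ^ 4 := by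
          gcongr
      _ = 2 * (1 / (m : ℝ) ^ (3 / 2 : ℝ)) := by
          rw [h2]
          rw [div_eq_iff (by positivity), mul_one_div, div_mul_eq_mul_div, eq_div_iff (by positivity)]
          calc _ = (m : ℝ) ^ 3 * 2 * √(m : ℝ) ^ 2 := by ring
            _ = _ := by rw [hss]; ring
  have hA : ∀ᵐ ω ∂P, Tendsto
      (fun m : ℕ => (∑ i ∈ Finset.range (m ^ 2), D i ω) ^ 2 / (m : ℝ) ^ 4) atTop (𝓝 0) := by
    refine ae_tendsto_zero_of_summable_integral (fun m => ?_) (fun m ω => by positivity) hsum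
      fun m => ?_
    · exact (memLp_finsetSum (Finset.range (m ^ 2)) fun i _ => hL2 i).integrable_sq.div_const _
    rw [integral_div, sum_sq_eq_of_orthogonal hL2 horth]
    calc (∑ i ∈ Finset.range (m ^ 2), ∫ ω, D i ω ^ 2 ∂P) / (m : ℝ) ^ 4
        ≤ (∑ i ∈ Finset.range (m ^ 2), (1 + C) * √(m + 1 : ℝ)) / (m : ℝ) ^ 4 := by
          gcongr with i hi
          refine hsq m i ((Finset.mem_range.1 hi).trans_le ?_)
          gcongr; omega
      _ = (1 + C) * ((m : ℝ) ^ 2 * √(m + 1 : ℝ) / (m : ℝ) ^ 4) := by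
          simp; ring
      _ ≤ (1 + C) * (2 * (1 / (m : ℝ) ^ (3 / 2 : ℝ))) := by gcongr; exact hpow m
      _ ≤ 20 * (1 + C) * (1 / (m : ℝ) ^ (3 / 2 : ℝ)) := by
          have : 0 ≤ (1 + C) * (1 / (m : ℝ) ^ (3 / 2 : ℝ)) := by positivity
          linarith
  have hB : ∀ᵐ ω ∂P, Tendsto (fun m : ℕ =>
      (∑ i ∈ Finset.Ico (m ^ 2) ((m + 1) ^ 2), |D i ω|) ^ 2 / (m : ℝ) ^ 4) atTop (𝓝 0) := by
    refine ae_tendsto_zero_of_summable_integral (fun m => ?_) (fun m ω => by positivity) hsum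
      fun m => ?_
    · exact (memLp_finsetSum (Finset.Ico (m ^ 2) ((m + 1) ^ 2))
        fun i _ => (hL2 i).abs).integrable_sq.div_const _
    rcases Nat.eq_zero_or_pos m with rfl | hm
    · simp
    have hm' : (1 : ℝ) ≤ m := by exact_mod_cast hm
    have hcard : (Finset.Ico (m ^ 2) ((m + 1) ^ 2)).card = 2 * m + 1 := by
      rw [Nat.card_Ico]; have : (m + 1) ^ 2 = m ^ 2 + (2 * m + 1) := by ring
      omega
    rw [integral_div]
    calc (∫ ω, (∑ i ∈ Finset.Ico (m ^ 2) ((m + 1) ^ 2), |D i ω|) ^ 2 ∂P) / (m : ℝ) ^ 4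
        ≤ (∫ ω, (2 * m + 1) * ∑ i ∈ Finset.Ico (m ^ 2) ((m + 1) ^ 2), D i ω ^ 2 ∂P)
            / (m : ℝ) ^ 4 := by
          gcongr ?_ / _
          refine integral_mono
            (memLp_finsetSum _ fun i _ => (hL2 i).abs).integrable_sq
            ((integrable_finsetSum _ fun i _ => (hL2 i).integrable_sq).const_mul _) fun ω => ?_
          have := sq_sum_le_card_mul_sum_sq (s := Finset.Ico (m ^ 2) ((m + 1) ^ 2))
            (f := fun i => |D i ω|)
          rw [hcard] at this
          simpa using this
      _ = ((2 * m + 1) * ∑ i ∈ Finset.Ico (m ^ 2) ((m + 1) ^ 2), ∫ ω, D i ω ^ 2 ∂P)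
            / (m : ℝ) ^ 4 := by
          rw [integral_const_mul, integral_finsetSum _ fun i _ => (hL2 i).integrable_sq]
      _ ≤ ((2 * m + 1) * ∑ i ∈ Finset.Ico (m ^ 2) ((m + 1) ^ 2), (1 + C) * √(m + 1 : ℝ))
            / (m : ℝ) ^ 4 := by
          gcongr with i hi
          exact hsq m i (Finset.mem_Ico.1 hi).2
      _ = (2 * m + 1) ^ 2 * (1 + C) * √(m + 1 : ℝ) / (m : ℝ) ^ 4 := by
          rw [Finset.sum_const, hcard]; simp; ring
      _ ≤ (9 * (m : ℝ) ^ 2) * (1 + C) * √(m + 1 : ℝ) / (m : ℝ) ^ 4 := by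
          gcongr; nlinarith
      _ = 9 * (1 + C) * ((m : ℝ) ^ 2 * √(m + 1 : ℝ) / (m : ℝ) ^ 4) := by ring
      _ ≤ 9 * (1 + C) * (2 * (1 / (m : ℝ) ^ (3 / 2 : ℝ))) := by gcongr; exact hpow m
      _ ≤ 20 * (1 + C) * (1 / (m : ℝ) ^ (3 / 2 : ℝ)) := by
          have : 0 ≤ (1 + C) * (1 / (m : ℝ) ^ (3 / 2 : ℝ)) := by positivity
          linarith
  filter_upwards [hA, hB] with ω h1 h2 using tendsto_average_of_squares h1 h2

/-! ### Sequences of independent, identically distributed variables -/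

/-- The law of a sequence of independent real random variables with common law `μ`. -/
abbrev iidLaw (μ : Measure ℝ) [IsProbabilityMeasure μ] : Measure (ℕ → ℝ) :=
  Measure.infinitePi fun _ => μ

/-- Replacing one coordinate of an i.i.d. sequence by a fresh independent copy does not change the
law of the sequence. -/
lemma measurePreserving_update (μ : Measure ℝ) [IsProbabilityMeasure μ] (n : ℕ) :
    MeasurePreserving (fun p : (ℕ → ℝ) × ℝ => Function.update p.1 n p.2)
      ((iidLaw μ).prod μ) (iidLaw μ) := by
  have hm : Measurable fun p : (ℕ → ℝ) × ℝ => Function.update p.1 n p.2 := by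
    refine measurable_pi_iff.2 fun i => ?_
    by_cases h : i = n
    · subst h; simpa using measurable_snd
    · simp only [Function.update_of_ne h]
      fun_prop
  refine ⟨hm, Measure.eq_infinitePi _ fun s t ht => ?_⟩
  rw [Measure.map_apply hm (MeasurableSet.pi s.countable_toSet fun i _ => ht i)]
  have e : (fun p : (ℕ → ℝ) × ℝ => Function.update p.1 n p.2) ⁻¹' ((s : Set ℕ).pi t)
      = (((s.erase n : Finset ℕ) : Set ℕ).pi t) ×ˢ (if n ∈ s then t n else Set.univ) := by
    ext ⟨v, y⟩
    simp only [Set.mem_preimage, Set.mem_pi, Set.mem_prod, Finset.mem_coe, Finset.mem_erase]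
    constructor
    · intro h
      refine ⟨fun i hi => by simpa [Function.update_of_ne hi.1] using h i hi.2, ?_⟩
      split_ifs with hn
      · simpa using h n hn
      · trivial
    · rintro ⟨h1, h2⟩ i hi
      by_cases hin : i = n
      · subst hin; simpa [hi] using h2
      · simpa [Function.update_of_ne hin] using h1 i ⟨hin, hi⟩
  rw [e, Measure.prod_prod, Measure.infinitePi_pi _ (fun i _ => ht i)]
  by_cases hn : n ∈ s
  · simp only [hn, if_true]
    exact Finset.prod_erase_mul s (fun i => μ (t i)) hn
  · simp [hn]

/-- If `f` does not depend on the `n`-th coordinate and `g` averages to `0` over it, then `f` and `g`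
are orthogonal. -/
lemma integral_mul_eq_zero_of_resample {μ : Measure ℝ} [IsProbabilityMeasure μ]
    {f g : (ℕ → ℝ) → ℝ} (hf : Measurable f) (hg : Measurable g) {n : ℕ}
    (hfn : ∀ v y, f (Function.update v n y) = f v)
    (hgn : ∀ v, ∫ y, g (Function.update v n y) ∂μ = 0) :
    ∫ v, f v * g v ∂(iidLaw μ) = 0 := by
  by_cases hi : Integrable (fun v => f v * g v) (iidLaw μ)
  · have hp := measurePreserving_update μ n
    have hm : AEStronglyMeasurable (fun v => f v * g v) (iidLaw μ) :=
      (hf.mul hg).aestronglyMeasurable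
    have hi' : Integrable (fun p : (ℕ → ℝ) × ℝ => f (Function.update p.1 n p.2) *
        g (Function.update p.1 n p.2)) ((iidLaw μ).prod μ) := (hp.integrable_comp hm).2 hi
    rw [← hp.map_eq, integral_map hp.measurable.aemeasurable (hp.map_eq.symm ▸ hm),
      integral_prod _ hi']
    simp [hfn, integral_const_mul, hgn]
  · exact integral_undef hi

/-- The law of large numbers for adapted increments: `D n` is a function of the first `n + 1`
coordinates of an i.i.d. sequence which has mean zero given the first `n` of them. -/
theorem tendsto_average_of_adapted {μ : Measure ℝ} [IsProbabilityMeasure μ]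
    {D : ℕ → (ℕ → ℝ) → ℝ} {C : ℝ} (hmeas : ∀ n, Measurable (D n))
    (hint : ∀ n, Integrable (fun v => D n v ^ 8) (iidLaw μ))
    (hmom : ∀ n, ∫ v, D n v ^ 8 ∂(iidLaw μ) ≤ C * (n + 1))
    (hadapted : ∀ i j, i < j → ∀ v y, D i (Function.update v j y) = D i v)
    (hmean : ∀ n v, ∫ y, D n (Function.update v n y) ∂μ = 0) :
    ∀ᵐ v ∂(iidLaw μ), Tendsto (fun n : ℕ => (∑ i ∈ Finset.range n, D i v) / n) atTop (𝓝 0) :=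
  tendsto_average_of_orthogonal (fun n => (hmeas n).aestronglyMeasurable) hint hmom
    fun i j hij => integral_mul_eq_zero_of_resample (hmeas i) (hmeas j) (hadapted i j hij) (hmean j)

/-- The law of large numbers for a function of the individual coordinates of an i.i.d. sequence. -/
theorem tendsto_average_iid {μ : Measure ℝ} [IsProbabilityMeasure μ] {f : ℝ → ℝ}
    (hf : Measurable f) (hi : Integrable f μ) :
    ∀ᵐ v ∂(iidLaw μ), Tendsto (fun n : ℕ => (∑ i ∈ Finset.range n, f (v i)) / n) atTop
      (𝓝 (∫ x, f x ∂μ)) := by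
  have hev := fun i => measurePreserving_eval_infinitePi (fun _ : ℕ => μ) i
  have hid : ∀ i, IdentDistrib (f ∘ Function.eval i) f (iidLaw μ) μ := fun i =>
    ⟨(hf.comp (measurable_pi_apply i)).aemeasurable, hf.aemeasurable, by
      rw [← Measure.map_map hf (hev i).measurable, (hev i).map_eq]⟩
  have hind : iIndepFun (fun (i : ℕ) (v : ℕ → ℝ) => f (v i)) (iidLaw μ) :=
    iIndepFun_infinitePi (X := fun _ => f) fun _ => hf
  have h := strong_law_ae_real (fun (i : ℕ) (v : ℕ → ℝ) => f (v i))
    ((hid 0).integrable_iff.2 hi) (fun i j hij => hind.indepFun hij)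
    fun i => (hid i).trans (hid 0).symm
  have he : ∫ v, f (v 0) ∂(iidLaw μ) = ∫ x, f x ∂μ := (hid 0).integral_eq
  rwa [he] at h

/-! ### The exponential distribution -/

lemma expMeasure_eq_withDensity (r : ℝ) : expMeasure r =
    (volume.restrict (Set.Ioi (0 : ℝ))).withDensity
      fun x => ENNReal.ofReal (r * Real.exp (-(r * x))) := by
  have h : expMeasure r = volume.withDensity (exponentialPDF r) := rfl
  rw [h, ← restrict_Ioi_eq_restrict_Ici.symm, ← withDensity_indicator measurableSet_Ici]
  congr 1
  funext x
  by_cases hx : 0 ≤ x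
  · rw [exponentialPDF_of_nonneg hx, Set.indicator_of_mem (Set.mem_Ici.2 hx)]
  · rw [exponentialPDF_of_neg (not_le.1 hx), Set.indicator_of_notMem (by simpa using hx)]

lemma ae_pos_expMeasure (r : ℝ) : ∀ᵐ y ∂(expMeasure r), 0 < y := by
  rw [expMeasure_eq_withDensity]
  exact (withDensity_absolutelyContinuous _ _).ae_le (ae_restrict_mem measurableSet_Ioi)

lemma integral_expMeasure {r : ℝ} (hr : 0 < r) (f : ℝ → ℝ) :
    ∫ y, f y ∂(expMeasure r) = ∫ y in Set.Ioi (0 : ℝ), r * Real.exp (-(r * y)) * f y := by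
  rw [expMeasure_eq_withDensity, integral_withDensity_eq_integral_toReal_smul (by fun_prop)
    (ae_of_all _ fun _ => ENNReal.ofReal_lt_top)]
  refine integral_congr_ae (ae_of_all _ fun y => ?_)
  simp only [smul_eq_mul]
  rw [ENNReal.toReal_ofReal (by positivity)]

lemma integrable_expMeasure_iff {r : ℝ} (hr : 0 < r) (f : ℝ → ℝ) :
    Integrable f (expMeasure r) ↔
      IntegrableOn (fun y => r * Real.exp (-(r * y)) * f y) (Set.Ioi (0 : ℝ)) := by
  rw [expMeasure_eq_withDensity, integrable_withDensity_iff_integrable_smul' (by fun_prop)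
    (ae_of_all _ fun _ => ENNReal.ofReal_lt_top), IntegrableOn]
  refine integrable_congr (ae_of_all _ fun y => ?_)
  simp only [smul_eq_mul]
  rw [ENNReal.toReal_ofReal (by positivity)]

lemma integrable_pow_expMeasure {r : ℝ} (hr : 0 < r) (n : ℕ) :
    Integrable (fun y => y ^ n) (expMeasure r) := by
  rw [integrable_expMeasure_iff hr]
  have h := (integrableOn_rpow_mul_exp_neg_mul_rpow (s := n) (p := 1) (b := r)
    (by have : (0 : ℝ) ≤ n := n.cast_nonneg
        linarith) one_pos hr).const_mul r
  refine h.congr (ae_of_all _ fun y => ?_)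
  simp only [Real.rpow_natCast, Real.rpow_one]
  rw [neg_mul]; ring

lemma integral_pow_expMeasure {r : ℝ} (hr : 0 < r) (n : ℕ) :
    ∫ y, y ^ n ∂(expMeasure r) = n.factorial / r ^ n := by
  rw [integral_expMeasure hr]
  have h := Real.integral_rpow_mul_exp_neg_mul_Ioi (a := n + 1) (r := r) (by positivity) hr
  have e : ∀ y : ℝ, r * Real.exp (-(r * y)) * y ^ n
      = r * (y ^ ((n : ℝ) + 1 - 1) * Real.exp (-(r * y))) := fun y => by
    rw [add_sub_cancel_right, Real.rpow_natCast]; ring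
  simp_rw [e]
  rw [integral_const_mul, h, Real.Gamma_nat_eq_factorial]
  rw [show (n : ℝ) + 1 = ((n + 1 : ℕ) : ℝ) by push_cast; ring, Real.rpow_natCast,
    one_div, inv_pow]
  field_simp
  ring

lemma integral_id_expMeasure {r : ℝ} (hr : 0 < r) : ∫ y, y ∂(expMeasure r) = 1 / r := by
  simpa using integral_pow_expMeasure hr 1

lemma integral_sq_expMeasure {r : ℝ} (hr : 0 < r) : ∫ y, y ^ 2 ∂(expMeasure r) = 2 / r ^ 2 := by
  simpa using integral_pow_expMeasure hr 2

/-- The memoryless property: the overshoot of an exponential variable above a level `ρ`, on the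
event that the level is reached, is again exponential. -/
lemma integral_overshoot_expMeasure {r : ℝ} (hr : 0 < r) {ρ : ℝ} (hρ : 0 ≤ ρ) (f : ℝ → ℝ) :
    ∫ y, (if ρ ≤ y then f (y - ρ) else 0) ∂(expMeasure r)
      = Real.exp (-(r * ρ)) * ∫ y, f y ∂(expMeasure r) := by
  rw [integral_expMeasure hr, integral_expMeasure hr, ← integral_const_mul,
    ← integral_indicator measurableSet_Ioi, ← integral_indicator measurableSet_Ioi,
    ← integral_sub_right_eq_self (μ := volume)
      ((Set.Ioi (0 : ℝ)).indicator fun y => Real.exp (-(r * ρ)) * (r * Real.exp (-(r * y)) * f y)) ρ]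
  refine integral_congr_ae ?_
  filter_upwards [compl_mem_ae_iff.2 (measure_singleton ρ)] with y hy
  have hy : y ≠ ρ := hy
  rcases lt_or_gt_of_ne hy with h | h
  · rw [Set.indicator_of_notMem (s := Set.Ioi (0 : ℝ)) (a := y - ρ) (by simp; linarith)]
    simp only [Set.indicator_apply, if_neg (not_le.2 h), mul_zero, ite_self]
  · rw [Set.indicator_of_mem (Set.mem_Ioi.2 (hρ.trans_lt h)),
      Set.indicator_of_mem (Set.mem_Ioi.2 (sub_pos.2 h)), if_pos h.le,
      show -(r * y) = -(r * ρ) + -(r * (y - ρ)) by ring, Real.exp_add]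
    ring

/-- Consequently, a function of the overshoot which is centred under the exponential law has
mean zero on the event that the level is reached. -/
lemma integral_overshoot_centred {r : ℝ} (hr : 0 < r) {ρ : ℝ} (hρ : 0 ≤ ρ) {φ : ℝ → ℝ}
    (hφ : Integrable φ (expMeasure r)) (c : ℝ) :
    ∫ y, (if ρ ≤ y then (φ (y - ρ) - ∫ z, φ z ∂(expMeasure r)) * c else 0) ∂(expMeasure r) = 0 := by
  have := isProbabilityMeasure_expMeasure hr
  rw [integral_overshoot_expMeasure hr hρ fun y => (φ y - ∫ z, φ z ∂(expMeasure r)) * c,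
    integral_mul_const, integral_sub hφ (integrable_const _)]
  simp

lemma integral_tail_expMeasure {r : ℝ} (hr : 0 < r) {u : ℝ} (hu : 0 ≤ u) (c : ℝ) :
    ∫ z, (if u ≤ z then c else 0) ∂(expMeasure r) = Real.exp (-(r * u)) * c := by
  have := isProbabilityMeasure_expMeasure hr
  rw [integral_overshoot_expMeasure hr hu fun _ => c]
  simp

/-- The compensator of a Poisson process, up to its first point: the expected value of `b` at an
exponential time equals the rate times the expected integral of `b` up to that time. -/
lemma integral_compensator_expMeasure {r : ℝ} (hr : 0 < r) {b : ℝ → ℝ} (hb : Measurable b)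
    (hi : Integrable b (expMeasure r)) :
    ∫ z, (b z - r * ∫ u in (0 : ℝ)..z, b u) ∂(expMeasure r) = 0 := by
  have := isProbabilityMeasure_expMeasure hr
  set E := expMeasure r
  set k : ℝ → ℝ → ℝ := fun z u => if u ≤ z then b u else 0 with hk
  have hkm : Measurable (Function.uncurry k) := by
    refine Measurable.ite (measurableSet_le measurable_snd measurable_fst) ?_ measurable_const
    exact hb.comp measurable_snd
  have hexp : IntegrableOn (fun u => Real.exp (-(r * u)) * b u) (Set.Ioi (0 : ℝ)) := by
    have := ((integrable_expMeasure_iff hr b).1 hi).const_mul r⁻¹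
    refine this.congr (ae_of_all _ fun y => ?_)
    field_simp
  have hkint : Integrable (Function.uncurry k) (E.prod (volume.restrict (Set.Ioi (0 : ℝ)))) := by
    rw [integrable_prod_iff' hkm.aestronglyMeasurable]
    constructor
    · refine ae_of_all _ fun u => ?_
      refine Integrable.mono' (integrable_const |b u|)
        (hkm.comp (measurable_id.prodMk measurable_const)).aestronglyMeasurable
        (ae_of_all _ fun z => ?_)
      simp only [Function.uncurry, hk]
      split_ifs <;> simp
    · refine hexp.norm.congr ?_
      filter_upwards [ae_restrict_mem measurableSet_Ioi] with u hu
      have e : ∀ z, ‖Function.uncurry k (z, u)‖ = if u ≤ z then |b u| else 0 := fun z => by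
        simp only [Function.uncurry, hk]
        split_ifs <;> simp
      simp_rw [e]
      rw [integral_tail_expMeasure hr (le_of_lt hu)]
      simp
  have hkz : ∀ᵐ z ∂E, ∫ u in Set.Ioi (0 : ℝ), k z u = ∫ u in (0 : ℝ)..z, b u := by
    filter_upwards [ae_pos_expMeasure r] with z hz
    rw [intervalIntegral.integral_of_le hz.le, ← integral_indicator measurableSet_Ioi,
      ← integral_indicator measurableSet_Ioc]
    congr 1
    funext u
    simp only [Set.indicator_apply, Set.mem_Ioi, Set.mem_Ioc, hk]
    by_cases h1 : 0 < u <;> by_cases h2 : u ≤ z <;> simp [h1, h2]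
  have hI : Integrable (fun z => ∫ u in (0 : ℝ)..z, b u) E := hkint.integral_prod_left.congr hkz
  -- exchanging the integrals turns the one over `z` into the tail probability of `u`
  rw [integral_sub hi (hI.const_mul r), integral_const_mul, ← integral_congr_ae hkz,
    integral_integral_swap hkint, sub_eq_zero]
  rw [integral_expMeasure hr b, ← integral_const_mul]
  refine setIntegral_congr_fun measurableSet_Ioi fun u hu => ?_
  simp only [hk]
  rw [integral_tail_expMeasure hr (le_of_lt hu)]
  ring

/-! ### Averages of real sequences -/

lemma exists_sum_le_of_average {f : ℕ → ℝ} {L : ℝ}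
    (h : Tendsto (fun n : ℕ => (∑ i ∈ Finset.range n, f i) / n) atTop (𝓝 L)) :
    ∃ A : ℝ, 0 < A ∧ ∀ n : ℕ, ∑ i ∈ Finset.range n, f i ≤ A * n := by
  obtain ⟨b, hb⟩ := h.bddAbove_range
  refine ⟨max b 1, by positivity, fun n => ?_⟩
  rcases Nat.eq_zero_or_pos n with rfl | hn
  · simp
  have hn' : (0 : ℝ) < n := by exact_mod_cast hn
  rw [← div_le_iff₀ hn']
  exact (hb ⟨n, rfl⟩).trans (le_max_left _ _)

lemma exists_le_mul_of_average {f : ℕ → ℝ} (hf : ∀ i, 0 ≤ f i) {L : ℝ}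
    (h : Tendsto (fun n : ℕ => (∑ i ∈ Finset.range n, f i) / n) atTop (𝓝 L)) :
    ∃ A : ℝ, 0 < A ∧ ∀ n : ℕ, f n ≤ A * (n + 1) := by
  obtain ⟨A, hA, hle⟩ := exists_sum_le_of_average h
  refine ⟨A, hA, fun n => ?_⟩
  have := hle (n + 1)
  rw [Finset.sum_range_succ] at this
  push_cast at this
  linarith [Finset.sum_nonneg fun i (_ : i ∈ Finset.range n) => hf i]

lemma exists_linear_bound {T : ℕ → ℝ} {δ : ℝ} (hδ : 0 < δ) (hT : ∀ n, 0 ≤ T n)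
    (h : ∀ᶠ n : ℕ in atTop, δ * n ≤ T n) :
    ∃ C : ℝ, 0 < C ∧ ∀ n : ℕ, (n : ℝ) + 1 ≤ C * (1 + T n) := by
  obtain ⟨N, hN⟩ := eventually_atTop.1 h
  refine ⟨1 / δ + N + 1, by positivity, fun n => ?_⟩
  have h0 := hT n
  rcases le_total N n with hn | hn
  · have h1 : (n : ℝ) ≤ 1 / δ * T n := by
      rw [one_div_mul_eq_div, le_div_iff₀ hδ, mul_comm]; exact hN n hn
    have h2 : 0 ≤ 1 / δ := by positivity
    have h3 : 0 ≤ (N : ℝ) * (1 + T n) := by positivity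
    nlinarith
  · have h1 : (n : ℝ) ≤ N := by exact_mod_cast hn
    have h2 : 0 ≤ 1 / δ := by positivity
    have h3 : 0 ≤ (1 / δ + N + 1) * T n := by positivity
    nlinarith

lemma exists_le_lt_succ {T : ℕ → ℝ} {t : ℝ} (h0 : T 0 ≤ t) (hT : Tendsto T atTop atTop) :
    ∃ K, T K ≤ t ∧ t < T (K + 1) := by
  classical
  have hp : ∃ n, t < T n := (hT.eventually_gt_atTop t).exists
  have hne : Nat.find hp ≠ 0 := fun h => by
    have := Nat.find_spec hp
    rw [h] at this
    linarith
  obtain ⟨K, hK⟩ := Nat.exists_eq_succ_of_ne_zero hne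
  refine ⟨K, not_lt.1 (Nat.find_min hp (by omega)), ?_⟩
  have := Nat.find_spec hp
  rwa [hK] at this

/-- Renewal-reward interpolation: a monotone function which is known at the ends of the cycles has
the long-run average given by the ratio of the average reward and the average cycle length. -/
lemma tendsto_div_of_cycles {F : ℝ → ℝ} {T : ℕ → ℝ} {R ℓ : ℝ} (hF : MonotoneOn F (Set.Ici 0))
    (hF0 : 0 ≤ F 0) (hT0 : T 0 = 0) (hTm : Monotone T) (hℓ : 0 < ℓ)
    (hT : Tendsto (fun n : ℕ => T n / n) atTop (𝓝 ℓ))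
    (hR : Tendsto (fun n : ℕ => F (T n) / n) atTop (𝓝 R)) :
    Tendsto (fun t => F t / t) atTop (𝓝 (R / ℓ)) := by
  have hTpos : ∀ n, 0 ≤ T n := fun n => hT0 ▸ hTm (Nat.zero_le n)
  have hTtop : Tendsto T atTop atTop := by
    refine (tendsto_natCast_atTop_atTop.atTop_mul_pos hℓ hT).congr' ?_
    filter_upwards [eventually_gt_atTop 0] with n hn
    have : (n : ℝ) ≠ 0 := by exact_mod_cast hn.ne'
    field_simp
  have hex : ∀ t : ℝ, ∃ K, 0 ≤ t → T K ≤ t ∧ t < T (K + 1) := fun t => by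
    by_cases ht : 0 ≤ t
    · obtain ⟨K, hK⟩ := exists_le_lt_succ (hT0.trans_le ht) hTtop
      exact ⟨K, fun _ => hK⟩
    · exact ⟨0, fun h => absurd h ht⟩
  choose K hK using hex
  have hKtop : Tendsto K atTop atTop := by
    refine tendsto_atTop.2 fun b => ?_
    filter_upwards [eventually_ge_atTop (T b), eventually_ge_atTop 0] with t ht ht0
    by_contra hlt
    have h1 : T (K t + 1) ≤ T b := hTm (by omega)
    linarith [(hK t ht0).2]
  have hquot : Tendsto (fun n : ℕ => (n : ℝ) / ((n : ℝ) + 1)) atTop (𝓝 1) :=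
    tendsto_natCast_div_add_atTop 1
  have hT' := hT.comp (tendsto_add_atTop_nat 1)
  have hR' := hR.comp (tendsto_add_atTop_nat 1)
  have hlow : Tendsto (fun n : ℕ => F (T n) / T (n + 1)) atTop (𝓝 (R / ℓ)) := by
    have := (hR.mul hquot).div hT' hℓ.ne'
    rw [mul_one] at this
    refine this.congr' ?_
    filter_upwards [eventually_gt_atTop 0] with n hn
    have h1 : (n : ℝ) ≠ 0 := by exact_mod_cast hn.ne'
    have h2 : (n : ℝ) + 1 ≠ 0 := by positivity
    simp only [Function.comp_apply, Pi.div_apply]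
    push_cast
    field_simp
  have hupp : Tendsto (fun n : ℕ => F (T (n + 1)) / T n) atTop (𝓝 (R / ℓ)) := by
    have := (hR'.div hquot one_ne_zero).div hT hℓ.ne'
    rw [div_one] at this
    refine this.congr' ?_
    filter_upwards [eventually_gt_atTop 0] with n hn
    have h1 : (n : ℝ) ≠ 0 := by exact_mod_cast hn.ne'
    have h2 : (n : ℝ) + 1 ≠ 0 := by positivity
    simp only [Function.comp_apply, Pi.div_apply]
    push_cast
    field_simp
  have hev : ∀ᶠ t in atTop, 0 < t ∧ 0 < T (K t) :=
    (eventually_gt_atTop 0).and ((hTtop.comp hKtop).eventually_gt_atTop 0)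
  refine tendsto_of_tendsto_of_tendsto_of_le_of_le' (hlow.comp hKtop) (hupp.comp hKtop) ?_ ?_
  · filter_upwards [hev] with t ht
    obtain ⟨h1, h2⟩ := hK t ht.1.le
    have hFT : 0 ≤ F (T (K t)) := hF0.trans (hF Set.self_mem_Ici (hTpos _) (hTpos _))
    have hle := hF (hTpos (K t)) ht.1.le h1
    exact div_le_div₀ (hFT.trans hle) hle ht.1 h2.le
  · filter_upwards [hev] with t ht
    obtain ⟨h1, h2⟩ := hK t ht.1.le
    have hFT : 0 ≤ F t := hF0.trans (hF Set.self_mem_Ici ht.1.le ht.1.le)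
    have hle := hF ht.1.le (hTpos _) h2.le
    exact div_le_div₀ (hFT.trans hle) hle ht.2 h1

/-! ### The server as a Markov chain indexed by the arrivals -/

/-- The state in which the server was left after the arrival preceding the `n`-th one: the remaining
service time, measured from that arrival, and the number of successful updates so far.
The `n`-th arrival is successful if and only if the remaining service time is at most `x n`; then
the server has been idle for the time `x n - (server x s n).1`. -/
def server (x s : ℕ → ℝ) : ℕ → ℝ × ℕ
  | 0 => (0, 0)
  | n + 1 => if (server x s n).1 ≤ x n then (s (server x s n).2, (server x s n).2 + 1)
      else ((server x s n).1 - x n, (server x s n).2)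

/-- The length of the idle period that precedes the arrival of the `k`-th successful update. -/
def idle (x s : ℕ → ℝ) : ℕ → ℝ
  | 0 => arrivalTime x s 0
  | k + 1 => arrivalTime x s (k + 1) - departureTime x s k

/-- The sequence shifted by one place, starting with `0`. -/
def prev (s : ℕ → ℝ) : ℕ → ℝ
  | 0 => 0
  | k + 1 => s k

/-- The beginning of the `k`-th cycle, which consists of the `k`-th idle period and the subsequent
service: it is `0` for `k = 0`, and the `(k - 1)`-st departure time for `k > 0`. -/
def cycleStart (x s : ℕ → ℝ) (k : ℕ) : ℝ := ∑ i ∈ Finset.range k, (idle x s i + s i)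

section Paths

variable {x s : ℕ → ℝ}

lemma cycleStart_succ (k : ℕ) : cycleStart x s (k + 1) = cycleStart x s k + (idle x s k + s k) :=
  Finset.sum_range_succ _ _

lemma cycleStart_succ_eq_departureTime (k : ℕ) :
    cycleStart x s (k + 1) = departureTime x s k := by
  induction k with
  | zero => simp [cycleStart, idle, departureTime]
  | succ k ih => rw [cycleStart_succ, ih]; simp only [idle, departureTime]; ring

lemma server_nonneg (hs : ∀ k, 0 ≤ s k) (n : ℕ) : 0 ≤ (server x s n).1 := by
  cases n with
  | zero => simp [server]
  | succ n =>
    rw [server]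
    split_ifs with h
    · exact hs _
    · exact (sub_pos.2 (not_le.1 h)).le

lemma server_count_le (n : ℕ) : (server x s n).2 ≤ n := by
  induction n with
  | zero => simp [server]
  | succ n ih => rw [server]; split_ifs <;> simp <;> omega

lemma epoch_succ (G : ℕ → ℝ) (n : ℕ) : epoch G (n + 1) = epoch G n + G (n + 1) :=
  Finset.sum_range_succ _ _

/-- If the arrivals up to `n` that follow the `k`-th successful update come during its service, and
arrival `n + 1` comes after it, then the latter is the next successful update. -/
lemma successIndex_eq_of_server {n k : ℕ}
    (h2 : successIndex x s k ≤ n)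
    (h3 : ∀ m, successIndex x s k < m → m ≤ n → epoch x m < departureTime x s k)
    (h5 : departureTime x s k ≤ epoch x (n + 1)) :
    successIndex x s (k + 1) = n + 1 := by
  rw [successIndex]
  refine le_antisymm (Nat.sInf_le ⟨by omega, h5⟩) ?_
  refine le_csInf ⟨n + 1, by omega, h5⟩ fun m hm => ?_
  by_contra hlt
  have := h3 m hm.1 (by omega)
  exact absurd hm.2 (not_le.2 this)

/-- After the arrival `n`, if `k` is the index of the latest successful update, then the state of the
server is the time left until the departure of that update. -/
lemma server_spec (hx : 0 ≤ x 0) (n : ℕ) : ∃ k, (server x s (n + 1)).2 = k + 1 ∧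
    successIndex x s k ≤ n ∧
    (∀ m, successIndex x s k < m → m ≤ n → epoch x m < departureTime x s k) ∧
    (server x s (n + 1)).1 = departureTime x s k - epoch x n := by
  induction n with
  | zero =>
    refine ⟨0, by simp [server, hx], by simp [successIndex],
      fun m h1 h2 => by simp [successIndex] at h1; omega, ?_⟩
    simp [server, hx, departureTime, arrivalTime, successIndex]
  | succ n ih =>
    obtain ⟨k, h1, h2, h3, h4⟩ := ih
    have hcond : (server x s (n + 1)).1 ≤ x (n + 1) ↔ departureTime x s k ≤ epoch x (n + 1) := by
      rw [h4, epoch_succ]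
      constructor <;> intro h <;> linarith
    rw [server]
    split_ifs with h
    -- the next successful update, or one more arrival during the current service
    · have hsi := successIndex_eq_of_server h2 h3 (hcond.1 h)
      refine ⟨k + 1, by simp [h1], hsi.le, fun m h1 h2 => by omega, ?_⟩
      simp [departureTime, arrivalTime, hsi, h1]
    · refine ⟨k, h1, by omega, fun m hm1 hm2 => ?_, ?_⟩
      · rcases Nat.lt_or_ge n m with hm | hm
        · obtain rfl : m = n + 1 := by omega
          exact not_le.1 fun h' => h (hcond.2 h')
        · exact h3 m hm1 hm
      · simp only [h4, epoch_succ]; ring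

/-- The overshoot seen by the chain at a successful arrival is the preceding idle period. -/
lemma idle_server (hx : 0 ≤ x 0) (n : ℕ) (h : (server x s n).1 ≤ x n) :
    idle x s (server x s n).2 = x n - (server x s n).1 := by
  cases n with
  | zero => simp [server, idle, arrivalTime, successIndex, epoch]
  | succ n =>
    obtain ⟨k, h1, h2, h3, h4⟩ := server_spec (s := s) hx n
    have h5 : departureTime x s k ≤ epoch x (n + 1) := by rw [epoch_succ]; linarith
    rw [h1, idle, arrivalTime, successIndex_eq_of_server h2 h3 h5, h4, epoch_succ]
    ring

lemma epoch_le_cycleStart (hx : 0 ≤ x 0) (hs : ∀ k, 0 ≤ s k) (n : ℕ) :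
    epoch x n ≤ cycleStart x s (server x s (n + 1)).2 := by
  obtain ⟨k, h1, -, -, h4⟩ := server_spec (s := s) hx n
  rw [h1, cycleStart_succ_eq_departureTime]
  linarith [server_nonneg (x := x) hs (n + 1)]

/-- Sums over the successful arrivals are sums over the cycles. -/
lemma sum_success_eq (hx : 0 ≤ x 0) (ψ : ℝ → ℝ) (g : ℕ → ℝ) (N : ℕ) :
    ∑ n ∈ Finset.range N,
        (if (server x s n).1 ≤ x n then ψ (x n - (server x s n).1) * g (server x s n).2 else 0)
      = ∑ k ∈ Finset.range (server x s N).2, ψ (idle x s k) * g k := by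
  induction N with
  | zero => simp [server]
  | succ N ih =>
    rw [Finset.sum_range_succ, ih, server]
    split_ifs with h
    · rw [Finset.sum_range_succ, idle_server hx N h]
    · simp

lemma exists_success {N k : ℕ} (h : k < (server x s N).2) :
    ∃ n < N, (server x s n).2 = k ∧ (server x s n).1 ≤ x n := by
  induction N with
  | zero => simp [server] at h
  | succ N ih =>
    rw [server] at h
    split_ifs at h with h'
    · rcases Nat.lt_or_ge k (server x s N).2 with hk | hk
      · obtain ⟨n, hn, hn'⟩ := ih hk
        exact ⟨n, by omega, hn'⟩
      · exact ⟨N, by omega, by simp at h; omega, h'⟩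
    · obtain ⟨n, hn, hn'⟩ := ih h
      exact ⟨n, by omega, hn'⟩

/-! ### The number of successful updates -/

/-- The averages over all arrivals of `ψ`, applied to the idle time found by a successful arrival
and weighted by `g` of the number of previous successes, tend to `0`; dropped arrivals contribute
`0`. -/
def AverageVanishes (x s : ℕ → ℝ) (ψ : ℝ → ℝ) (g : ℕ → ℝ) : Prop :=
  Tendsto (fun N : ℕ => (∑ n ∈ Finset.range N,
    (if (server x s n).1 ≤ x n then ψ (x n - (server x s n).1) * g (server x s n).2 else 0)) / N)
    atTop (𝓝 0)

/-- A positive fraction of the updates is successful: the time of arrival `n`, about `a * n`, is at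
most the sum of the idle periods and services so far, which is of the order of their number. -/
lemma exists_count_bound {a m : ℝ} (ha : 0 < a) (hx : 0 ≤ x 0) (hs : ∀ k, 0 ≤ s k)
    (hxavg : Tendsto (fun n : ℕ => (∑ i ∈ Finset.range n, x i) / n) atTop (𝓝 a))
    (hsavg : Tendsto (fun n : ℕ => (∑ i ∈ Finset.range n, s i) / n) atTop (𝓝 m))
    (hidle : AverageVanishes x s (fun w => w - a) fun _ => 1) :
    ∃ C : ℝ, 0 < C ∧ ∀ n : ℕ, (n : ℝ) + 1 ≤ C * (1 + (server x s n).2) := by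
  obtain ⟨A, hA, hsum⟩ := exists_sum_le_of_average hsavg
  refine exists_linear_bound (δ := a / 2 / (a + A)) (by positivity) (fun n => Nat.cast_nonneg _) ?_
  have h := (hxavg.sub hidle).eventually_const_lt (u := a / 2) (by linarith)
  filter_upwards [h, eventually_gt_atTop 0] with N hN hN0
  obtain ⟨n, rfl⟩ := Nat.exists_eq_succ_of_ne_zero hN0.ne'
  have hN' : (0 : ℝ) < ((n + 1 : ℕ) : ℝ) := by positivity
  have e := sum_success_eq (s := s) hx (fun w => w - a) (fun _ => 1) (n + 1)
  beta_reduce at e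
  rw [e, ← sub_div, lt_div_iff₀ hN'] at hN
  have he : ∑ i ∈ Finset.range (n + 1), x i ≤ cycleStart x s (server x s (n + 1)).2 :=
    epoch_le_cycleStart hx hs n
  set c := (server x s (n + 1)).2
  have hc := hsum c
  simp only [mul_one, Finset.sum_sub_distrib, Finset.sum_const, Finset.card_range,
    nsmul_eq_mul] at hN
  rw [cycleStart, Finset.sum_add_distrib] at he
  rw [div_mul_eq_mul_div, div_le_iff₀ (by positivity)]
  have : a / 2 * ((n + 1 : ℕ) : ℝ) ≤ (c : ℝ) * a + A * c := by linarith
  calc _ ≤ _ := this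
    _ = _ := by ring

lemma exists_server_count_eq {C : ℝ} (hC : 0 < C)
    (hcount : ∀ n : ℕ, (n : ℝ) + 1 ≤ C * (1 + (server x s n).2)) (K : ℕ) :
    ∃ n, (server x s n).2 = K ∧ (server x s n).1 ≤ x n := by
  obtain ⟨N, hN⟩ := exists_nat_gt (C * (1 + K))
  have h1 := hcount N
  have h2 : C * (1 + (K : ℝ)) < C * (1 + (server x s N).2) := by linarith
  have h3 : K < (server x s N).2 := by
    have := lt_of_mul_lt_mul_left h2 hC.le
    have h4 : (K : ℝ) < (server x s N).2 := by linarith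
    exact_mod_cast h4
  obtain ⟨n, -, hn⟩ := exists_success h3
  exact ⟨n, hn⟩

/-- Averages over the arrivals may be replaced by averages over the cycles. -/
lemma tendsto_cycle_average {C : ℝ} (hx : 0 ≤ x 0) (hC : 0 < C)
    (hcount : ∀ n : ℕ, (n : ℝ) + 1 ≤ C * (1 + (server x s n).2)) {ψ : ℝ → ℝ} {g : ℕ → ℝ}
    (h : AverageVanishes x s ψ g) :
    Tendsto (fun K : ℕ => (∑ k ∈ Finset.range K, ψ (idle x s k) * g k) / K) atTop (𝓝 0) := by
  choose N hN _ using exists_server_count_eq hC hcount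
  have hNtop : Tendsto N atTop atTop :=
    tendsto_atTop_mono (fun K => by simpa [hN] using server_count_le (x := x) (s := s) (N K))
      tendsto_id
  have h1 := (((tendsto_zero_iff_abs_tendsto_zero _).1 h).comp hNtop).const_mul (2 * C)
  rw [mul_zero] at h1
  refine squeeze_zero_norm' ?_ h1
  filter_upwards [eventually_ge_atTop 1] with K hK
  have hK' : (1 : ℝ) ≤ K := by exact_mod_cast hK
  have h2 := hcount (N K)
  rw [hN] at h2
  have h3 : (K : ℝ) ≤ N K := by
    have := server_count_le (x := x) (s := s) (N K)
    rw [hN] at this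
    exact_mod_cast this
  simp only [Function.comp_apply]
  rw [sum_success_eq hx, hN, Real.norm_eq_abs, abs_div, abs_div, Nat.abs_cast, Nat.abs_cast,
    ← mul_div_assoc, div_le_div_iff₀ (by linarith) (by linarith)]
  set S := |∑ k ∈ Finset.range K, ψ (idle x s k) * g k|
  have hS : 0 ≤ S := abs_nonneg _
  have h4 : (N K : ℝ) ≤ 2 * C * K := by nlinarith
  calc S * (N K : ℝ) ≤ S * (2 * C * K) := by gcongr
    _ = _ := by ring

/-! ### The age over a cycle -/

/-- The `k`-th cycle starts at `cycleStart x s k` with the age `prev s k`, which then grows at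
unit speed. -/
lemma age_of_mem_cycle (hlt : StrictMono (cycleStart x s)) {K : ℕ} {τ : ℝ}
    (h1 : cycleStart x s K ≤ τ) (h2 : τ < cycleStart x s (K + 1)) :
    age x s τ = τ - cycleStart x s K + prev s K := by
  have hiff : ∀ k, departureTime x s k ≤ τ ↔ k < K := fun k => by
    rw [← cycleStart_succ_eq_departureTime]
    constructor
    · intro h
      have := hlt.lt_iff_lt.1 (h.trans_lt h2)
      omega
    · intro h
      exact (hlt.monotone (show k + 1 ≤ K by omega)).trans h1
  rw [age]
  cases K with
  | zero => simp [hiff, cycleStart, prev]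
  | succ K =>
    rw [if_pos ⟨K, (hiff K).2 (by omega)⟩]
    have hsup : latestReceived x s τ = K := by
      have : {k : ℕ | departureTime x s k ≤ τ} = Set.Iic K := by
        ext k; simp [hiff]
      rw [latestReceived, this, csSup_Iic]
    rw [hsup, cycleStart_succ_eq_departureTime, departureTime, prev]
    ring

lemma intervalIntegrable_age_cycle (hlt : StrictMono (cycleStart x s)) (K : ℕ) :
    IntervalIntegrable (age x s) volume (cycleStart x s K) (cycleStart x s (K + 1)) := by
  have hc : IntervalIntegrable (fun τ => τ - cycleStart x s K + prev s K) volume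
      (cycleStart x s K) (cycleStart x s (K + 1)) :=
    Continuous.intervalIntegrable (by fun_prop) _ _
  refine hc.congr_ae ?_
  rw [Set.uIoc_of_le (hlt (Nat.lt_succ_self K)).le, ← restrict_Ioo_eq_restrict_Ioc]
  filter_upwards [ae_restrict_mem measurableSet_Ioo] with τ hτ
  exact (age_of_mem_cycle hlt hτ.1.le hτ.2).symm

lemma integral_age_cycle (hlt : StrictMono (cycleStart x s)) (K : ℕ) :
    ∫ τ in cycleStart x s K..cycleStart x s (K + 1), age x s τ
      = prev s K * (idle x s K + s K) + (idle x s K + s K) ^ 2 / 2 := by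
  have hle := (hlt (Nat.lt_succ_self K)).le
  have h1 : ∫ τ in cycleStart x s K..cycleStart x s (K + 1), age x s τ
      = ∫ τ in cycleStart x s K..cycleStart x s (K + 1), (τ + (prev s K - cycleStart x s K)) := by
    rw [intervalIntegral.integral_of_le hle, intervalIntegral.integral_of_le hle,
      integral_Ioc_eq_integral_Ioo, integral_Ioc_eq_integral_Ioo]
    refine setIntegral_congr_fun measurableSet_Ioo fun τ hτ => ?_
    simp only [age_of_mem_cycle hlt hτ.1.le hτ.2]
    ring
  rw [h1, intervalIntegral.integral_add (Continuous.intervalIntegrable (by fun_prop) _ _)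
    (Continuous.intervalIntegrable (by fun_prop) _ _)]
  simp only [integral_id, intervalIntegral.integral_const, smul_eq_mul, cycleStart_succ]
  ring

/-- The age, put to `0` at negative times: a function on the whole line whose growth is controlled
everywhere. -/
def posAge (x s : ℕ → ℝ) (t : ℝ) : ℝ := if 0 ≤ t then age x s t else 0

/-- What almost every sample path of the arrivals and the services satisfies.  The averages of all
the quantities which enter the cycle lengths and the integrals of the age over the cycles
converge, and single terms grow slowly.  The parameters are the first two moments `a`, `b` of the
idle periods and the first two moments `m`, `v` of the service times. -/
structure IsTypical (x s : ℕ → ℝ) (a b m v : ℝ) : Prop where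
  arrival_pos : ∀ i, 0 < x i
  service_pos : ∀ i, 0 < s i
  arrival_average : Tendsto (fun n : ℕ => (∑ i ∈ Finset.range n, x i) / n) atTop (𝓝 a)
  arrival_growth : ∃ A : ℝ, 0 < A ∧ ∀ n : ℕ, x n ^ 8 ≤ A * (n + 1)
  service_average : Tendsto (fun n : ℕ => (∑ i ∈ Finset.range n, s i) / n) atTop (𝓝 m)
  service_sq_average : Tendsto (fun n : ℕ => (∑ i ∈ Finset.range n, s i ^ 2) / n) atTop (𝓝 v)
  service_prev_average :
    Tendsto (fun n : ℕ => (∑ i ∈ Finset.range n, prev s i) / n) atTop (𝓝 m)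
  service_mul_average :
    Tendsto (fun n : ℕ => (∑ i ∈ Finset.range n, prev s i * s i) / n) atTop (𝓝 (m ^ 2))
  service_growth : ∃ A : ℝ, 0 < A ∧ ∀ n : ℕ, s n ^ 8 ≤ A * (n + 1)
  idle_average : AverageVanishes x s (fun w => w - a) fun _ => 1
  idle_sq_average : AverageVanishes x s (fun w => w ^ 2 - b) fun _ => 1
  idle_mul_service_average : AverageVanishes x s (fun w => w - a) s
  idle_mul_prev_average : AverageVanishes x s (fun w => w - a) (prev s)

lemma prev_nonneg (hs : ∀ k, 0 ≤ s k) (k : ℕ) : 0 ≤ prev s k := by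
  cases k with
  | zero => exact le_rfl
  | succ k => exact hs k

namespace IsTypical

variable {a b m v : ℝ}

lemma exists_count_bound (h : IsTypical x s a b m v) (ha : 0 < a) :
    ∃ C : ℝ, 0 < C ∧ ∀ n : ℕ, (n : ℝ) + 1 ≤ C * (1 + (server x s n).2) :=
  BufferlessQueue.exists_count_bound ha (h.arrival_pos 0).le (fun k => (h.service_pos k).le)
    h.arrival_average h.service_average h.idle_average

lemma idle_nonneg (h : IsTypical x s a b m v) (ha : 0 < a) (k : ℕ) : 0 ≤ idle x s k := by
  obtain ⟨C, hC, hcount⟩ := h.exists_count_bound ha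
  obtain ⟨n, hn, hn'⟩ := exists_server_count_eq hC hcount k
  rw [← hn, idle_server (h.arrival_pos 0).le n hn']
  linarith

lemma strictMono_cycleStart (h : IsTypical x s a b m v) (ha : 0 < a) :
    StrictMono (cycleStart x s) :=
  strictMono_nat_of_lt_succ fun k => by
    rw [cycleStart_succ]
    linarith [h.idle_nonneg ha k, h.service_pos k]

lemma cycleStart_nonneg (h : IsTypical x s a b m v) (ha : 0 < a) (k : ℕ) :
    0 ≤ cycleStart x s k := by
  have h0 : cycleStart x s 0 = 0 := by simp [cycleStart]
  exact h0 ▸ (h.strictMono_cycleStart ha).monotone (Nat.zero_le k)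

/-- Averages over the cycles of a centred function of the idle periods vanish. -/
lemma tendsto_idle_average (h : IsTypical x s a b m v) (ha : 0 < a) {ψ : ℝ → ℝ} {g : ℕ → ℝ}
    (hψ : AverageVanishes x s ψ g) :
    Tendsto (fun K : ℕ => (∑ k ∈ Finset.range K, ψ (idle x s k) * g k) / K) atTop (𝓝 0) := by
  obtain ⟨C, hC, hcount⟩ := h.exists_count_bound ha
  exact tendsto_cycle_average (h.arrival_pos 0).le hC hcount hψ

lemma tendsto_cycleStart_div (h : IsTypical x s a b m v) (ha : 0 < a) :
    Tendsto (fun n : ℕ => cycleStart x s n / n) atTop (𝓝 (a + m)) := by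
  have h1 := ((h.tendsto_idle_average ha h.idle_average).add_const a).add h.service_average
  rw [zero_add] at h1
  refine h1.congr' ?_
  filter_upwards [eventually_gt_atTop 0] with n hn
  have hn' : (n : ℝ) ≠ 0 := by exact_mod_cast hn.ne'
  rw [cycleStart, Finset.sum_add_distrib]
  simp only [mul_one, Finset.sum_sub_distrib, Finset.sum_const, Finset.card_range, nsmul_eq_mul]
  field_simp
  ring

lemma service_mean_nonneg (h : IsTypical x s a b m v) : 0 ≤ m :=
  ge_of_tendsto' h.service_average fun n =>
    div_nonneg (Finset.sum_nonneg fun i _ => (h.service_pos i).le) n.cast_nonneg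

lemma tendsto_cycleStart (h : IsTypical x s a b m v) (ha : 0 < a) :
    Tendsto (cycleStart x s) atTop atTop := by
  have hm := h.service_mean_nonneg
  refine (tendsto_natCast_atTop_atTop.atTop_mul_pos (by linarith : 0 < a + m)
    (h.tendsto_cycleStart_div ha)).congr' ?_
  filter_upwards [eventually_gt_atTop 0] with n hn
  have : (n : ℝ) ≠ 0 := by exact_mod_cast hn.ne'
  field_simp

/-- The average over the cycles of the integral of the age over a cycle, obtained by expanding the
integral into products of idle periods and services. -/
lemma tendsto_reward_average (h : IsTypical x s a b m v) (ha : 0 < a) :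
    Tendsto (fun n : ℕ => (∑ K ∈ Finset.range n,
        (prev s K * (idle x s K + s K) + (idle x s K + s K) ^ 2 / 2)) / (n : ℝ)) atTop
      (𝓝 (m * (a + m) + (b + 2 * a * m + v) / 2)) := by
  have h1 := h.tendsto_idle_average ha h.idle_sq_average
  have h2 := h.tendsto_idle_average ha h.idle_mul_service_average
  have h3 := h.tendsto_idle_average ha h.idle_mul_prev_average
  have key := (((h3.add (h.service_prev_average.const_mul a)).add h.service_mul_average).add
    ((h1.add_const b).div_const 2)).add ((h2.add (h.service_average.const_mul a)).add
      (h.service_sq_average.div_const 2))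
  have e : 0 + a * m + m ^ 2 + (0 + b) / 2 + (0 + a * m + v / 2)
      = m * (a + m) + (b + 2 * a * m + v) / 2 := by ring
  rw [e] at key
  refine key.congr' ?_
  filter_upwards [eventually_gt_atTop 0] with n hn
  have hn' : (n : ℝ) ≠ 0 := by exact_mod_cast hn.ne'
  have hsum : ∑ K ∈ Finset.range n, (prev s K * (idle x s K + s K) + (idle x s K + s K) ^ 2 / 2)
      = ∑ k ∈ Finset.range n, (idle x s k - a) * prev s k + a * ∑ i ∈ Finset.range n, prev s i
        + ∑ i ∈ Finset.range n, prev s i * s i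
        + (∑ k ∈ Finset.range n, (idle x s k ^ 2 - b) * 1 + n * b) / 2
        + (∑ k ∈ Finset.range n, (idle x s k - a) * s k + a * ∑ i ∈ Finset.range n, s i
          + (∑ i ∈ Finset.range n, s i ^ 2) / 2) := by
    have hb : (n : ℝ) * b = ∑ K ∈ Finset.range n, b := by simp
    rw [hb]
    simp only [Finset.mul_sum, Finset.sum_div, ← Finset.sum_add_distrib]
    refine Finset.sum_congr rfl fun K _ => ?_
    ring
  rw [hsum]
  field_simp

lemma intervalIntegrable_age (h : IsTypical x s a b m v) (ha : 0 < a) {t u : ℝ} (ht : 0 ≤ t)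
    (hu : 0 ≤ u) : IntervalIntegrable (age x s) volume t u := by
  have h0 : cycleStart x s 0 = 0 := by simp [cycleStart]
  have main : ∀ {t : ℝ}, 0 ≤ t → IntervalIntegrable (age x s) volume 0 t := fun {t} ht => by
    obtain ⟨K, -, hK⟩ := exists_le_lt_succ (h0.trans_le ht) (h.tendsto_cycleStart ha)
    have hi := IntervalIntegrable.trans_iterate (n := K + 1) (a := cycleStart x s)
      fun k _ => intervalIntegrable_age_cycle (h.strictMono_cycleStart ha) k
    rw [h0] at hi
    refine hi.mono_set ?_
    rw [Set.uIcc_of_le ht, Set.uIcc_of_le (h.cycleStart_nonneg ha _)]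
    exact Set.Icc_subset_Icc_right hK.le
  exact (main ht).symm.trans (main hu)

lemma age_nonneg (h : IsTypical x s a b m v) (ha : 0 < a) {t : ℝ} (ht : 0 ≤ t) :
    0 ≤ age x s t := by
  obtain ⟨K, h1, h2⟩ := exists_le_lt_succ (T := cycleStart x s) (by simpa [cycleStart] using ht)
      (h.tendsto_cycleStart ha)
  rw [age_of_mem_cycle (h.strictMono_cycleStart ha) h1 h2]
  linarith [prev_nonneg (fun k => (h.service_pos k).le) K]

/-- The long-run time average of the age, by the renewal-reward argument. -/
lemma tendsto_time_average (h : IsTypical x s a b m v) (ha : 0 < a) :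
    Tendsto (fun t : ℝ => (∫ τ in (0 : ℝ)..t, age x s τ) / t) atTop
      (𝓝 ((m * (a + m) + (b + 2 * a * m + v) / 2) / (a + m))) := by
  have hm := h.service_mean_nonneg
  have h0 : cycleStart x s 0 = 0 := by simp [cycleStart]
  have hlt := h.strictMono_cycleStart ha
  refine tendsto_div_of_cycles (T := cycleStart x s) ?_ (by simp) h0 hlt.monotone (by linarith)
    (h.tendsto_cycleStart_div ha) ?_
  · intro t ht u hu htu
    have ht : 0 ≤ t := ht
    beta_reduce
    rw [← intervalIntegral.integral_add_adjacent_intervals (h.intervalIntegrable_age ha le_rfl ht)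
      (h.intervalIntegrable_age ha ht hu)]
    have := intervalIntegral.integral_nonneg (f := age x s) (μ := volume) htu
      fun τ hτ => h.age_nonneg ha (ht.trans hτ.1)
    linarith
  · refine (h.tendsto_reward_average ha).congr fun n => ?_
    have := intervalIntegral.sum_integral_adjacent_intervals (n := n) (a := cycleStart x s)
      (f := age x s) (μ := volume) fun k _ => intervalIntegrable_age_cycle hlt k
    rw [h0] at this
    rw [← this]
    simp_rw [integral_age_cycle hlt]

/-- The age at time `t` is at most of order `t ^ (1 / 8)`. -/
lemma posAge_growth (h : IsTypical x s a b m v) (ha : 0 < a) :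
    ∃ A : ℝ, 0 < A ∧ ∀ t, |posAge x s t| ^ 8 ≤ A * (1 + |t|) := by
  have hm := h.service_mean_nonneg
  obtain ⟨A, hA, hx⟩ := h.arrival_growth
  obtain ⟨B, hB, hs⟩ := h.service_growth
  obtain ⟨C, hC, hcount⟩ := h.exists_count_bound ha
  have hev : ∀ᶠ n : ℕ in atTop, (a / 2) * n ≤ cycleStart x s n := by
    filter_upwards [(h.tendsto_cycleStart_div ha).eventually_const_lt (u := a / 2) (by linarith),
      eventually_gt_atTop 0] with n hn hn0
    have : (0 : ℝ) < n := by exact_mod_cast hn0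
    exact ((lt_div_iff₀ this).1 hn).le
  obtain ⟨D, hD, hlin⟩ := exists_linear_bound (by positivity) (h.cycleStart_nonneg ha) hev
  refine ⟨3 ^ 7 * (B + A * C + B) * D, by positivity, fun t => ?_⟩
  by_cases ht : 0 ≤ t
  · rw [posAge, if_pos ht, abs_of_nonneg (h.age_nonneg ha ht), abs_of_nonneg ht]
    obtain ⟨K, h1, h2⟩ := exists_le_lt_succ (T := cycleStart x s) (by simpa [cycleStart] using ht)
      (h.tendsto_cycleStart ha)
    have hage := age_of_mem_cycle (h.strictMono_cycleStart ha) h1 h2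
    have hage0 := h.age_nonneg ha ht
    have hp0 := prev_nonneg (fun k => (h.service_pos k).le) K
    have hs0 := (h.service_pos K).le
    have hi0 := h.idle_nonneg ha K
    have hle : age x s t ≤ prev s K + idle x s K + s K := by
      rw [cycleStart_succ] at h2; linarith
    have hprev : prev s K ^ 8 ≤ B * (K + 1) := by
      cases K with
      | zero => simp [prev]; positivity
      | succ K =>
        refine (hs K).trans ?_
        push_cast
        nlinarith
    have hidle : idle x s K ^ 8 ≤ A * C * (K + 1) := by
      obtain ⟨n, hn, hn'⟩ := exists_server_count_eq hC hcount K
      have e := idle_server (h.arrival_pos 0).le n hn'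
      rw [hn] at e
      have hr := server_nonneg (x := x) (fun k => (h.service_pos k).le) n
      have hc := hcount n
      rw [hn] at hc
      calc idle x s K ^ 8 ≤ x n ^ 8 := by gcongr; linarith
        _ ≤ A * (n + 1) := hx n
        _ ≤ A * (C * (1 + K)) := by gcongr
        _ = _ := by ring
    have hpow : (prev s K + idle x s K + s K) ^ 8
        ≤ 3 ^ 7 * (prev s K ^ 8 + idle x s K ^ 8 + s K ^ 8) := by
      have := pow_sum_le_card_mul_sum_pow (s := Finset.univ) (f := ![prev s K, idle x s K, s K])
        (by intro i _; fin_cases i <;> simpa) 7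
      simpa [Fin.sum_univ_three] using this
    calc age x s t ^ 8 ≤ (prev s K + idle x s K + s K) ^ 8 := by gcongr
      _ ≤ 3 ^ 7 * (prev s K ^ 8 + idle x s K ^ 8 + s K ^ 8) := hpow
      _ ≤ 3 ^ 7 * (B * (K + 1) + A * C * (K + 1) + B * (K + 1)) := by
          gcongr
          exact hs K
      _ = 3 ^ 7 * (B + A * C + B) * (K + 1) := by ring
      _ ≤ 3 ^ 7 * (B + A * C + B) * (D * (1 + cycleStart x s K)) := by
          gcongr
          exact hlin K
      _ ≤ 3 ^ 7 * (B + A * C + B) * (D * (1 + t)) := by gcongr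
      _ = _ := by ring
  · rw [posAge, if_neg ht]
    simp only [abs_zero, ne_eq, OfNat.ofNat_ne_zero, not_false_eq_true, zero_pow]
    positivity

end IsTypical

end Paths

/-! ### Moments of functions of one coordinate -/

lemma integrable_const_add_pow {μ : Measure ℝ} [IsProbabilityMeasure μ]
    (hμ : ∀ k : ℕ, Integrable (fun y => y ^ k) μ) (c d : ℝ) (p n : ℕ) :
    Integrable (fun y => (c + d * y ^ p) ^ n) μ := by
  simp_rw [add_pow]
  refine integrable_finsetSum _ fun k _ => ?_
  have e : ∀ y : ℝ, c ^ k * (d * y ^ p) ^ (n - k) * (n.choose k : ℝ)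
      = (c ^ k * d ^ (n - k) * (n.choose k : ℝ)) * y ^ (p * (n - k)) := fun y => by
    rw [mul_pow, ← pow_mul]; ring
  simp_rw [e]
  exact (hμ _).const_mul _

lemma integrable_coord {μ : Measure ℝ} [IsProbabilityMeasure μ] {f : ℝ → ℝ}
    (hf : Integrable f μ) (i : ℕ) : Integrable (fun v : ℕ → ℝ => f (v i)) (iidLaw μ) :=
  ((measurePreserving_eval_infinitePi (fun _ : ℕ => μ) i).integrable_comp hf.1).2 hf

lemma integral_coord {μ : Measure ℝ} [IsProbabilityMeasure μ] {f : ℝ → ℝ}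
    (hf : Integrable f μ) (i : ℕ) : ∫ v : ℕ → ℝ, f (v i) ∂(iidLaw μ) = ∫ y, f y ∂μ := by
  have h := measurePreserving_eval_infinitePi (fun _ : ℕ => μ) i
  have h2 := integral_map (φ := Function.eval i) (f := f) h.measurable.aemeasurable
    (h.map_eq.symm ▸ hf.1)
  rw [h.map_eq] at h2
  exact h2.symm

lemma ae_forall_coord {μ : Measure ℝ} [IsProbabilityMeasure μ] {p : ℝ → Prop}
    (hp : ∀ᵐ y ∂μ, p y) : ∀ᵐ v ∂(iidLaw μ), ∀ i, p (v i) :=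
  ae_all_iff.2 fun i =>
    (measurePreserving_eval_infinitePi (fun _ : ℕ => μ) i).quasiMeasurePreserving.ae hp

/-- The terms of an i.i.d. sequence with a finite eighth moment grow slowly. -/
lemma ae_growth {μ : Measure ℝ} [IsProbabilityMeasure μ] (hμ : Integrable (fun y => y ^ 8) μ) :
    ∀ᵐ v ∂(iidLaw μ), ∃ A : ℝ, 0 < A ∧ ∀ n : ℕ, v n ^ 8 ≤ A * (n + 1) := by
  filter_upwards [tendsto_average_iid (f := fun y => y ^ 8) (by fun_prop) hμ] with v hv
  exact exists_le_mul_of_average (f := fun n => v n ^ 8) (fun i => by positivity) hv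

/-! ### Averages of the service times -/

lemma prev_update {i j : ℕ} (hij : i ≤ j) (v : ℕ → ℝ) (y : ℝ) :
    prev (Function.update v j y) i = prev v i := by
  cases i with
  | zero => rfl
  | succ i => exact Function.update_of_ne (by omega) _ _

lemma tendsto_prev_average {s : ℕ → ℝ} {m : ℝ}
    (h : Tendsto (fun n : ℕ => (∑ i ∈ Finset.range n, s i) / (n : ℝ)) atTop (𝓝 m)) :
    Tendsto (fun n : ℕ => (∑ i ∈ Finset.range n, prev s i) / (n : ℝ)) atTop (𝓝 m) := by
  rw [← tendsto_add_atTop_iff_nat 1]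
  have h1 := h.mul (tendsto_natCast_div_add_atTop (1 : ℝ))
  rw [mul_one] at h1
  refine h1.congr' ?_
  filter_upwards [eventually_gt_atTop 0] with n hn
  have hn' : (n : ℝ) ≠ 0 := by exact_mod_cast hn.ne'
  have hn1 : (n : ℝ) + 1 ≠ 0 := by positivity
  rw [Finset.sum_range_succ']
  simp only [prev]
  push_cast
  field_simp
  ring

/-- Successive services are uncorrelated, also in the sense of long-run averages. -/
lemma ae_service_mul_average {σ : Measure ℝ} [IsProbabilityMeasure σ]
    (hσ : ∀ k : ℕ, Integrable (fun y => y ^ k) σ) :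
    ∀ᵐ s ∂(iidLaw σ), Tendsto
      (fun n : ℕ => (∑ i ∈ Finset.range n, prev s i * (s i - ∫ y, y ∂σ)) / n) atTop (𝓝 0) := by
  set m := ∫ y, y ∂σ
  have hprev : ∀ n, Measurable fun v : ℕ → ℝ => prev v n := fun n => by
    cases n with
    | zero => exact measurable_const
    | succ n => exact measurable_pi_apply n
  have h1 : Integrable (fun y : ℝ => y) σ := by simpa using hσ 1
  have hc : Integrable (fun y : ℝ => (y - m) ^ 16) σ := by
    have := integrable_const_add_pow hσ (-m) 1 1 16
    simpa [neg_add_eq_sub] using this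
  have hp : ∀ n, Integrable (fun v : ℕ → ℝ => prev v n ^ 16) (iidLaw σ) ∧
      ∫ v, prev v n ^ 16 ∂(iidLaw σ) ≤ ∫ y, y ^ 16 ∂σ := fun n => by
    cases n with
    | zero => simpa [prev] using integral_nonneg fun y => by positivity
    | succ n => exact ⟨integrable_coord (hσ 16) n, (integral_coord (hσ 16) n).le⟩
  have hb : ∀ n, Integrable (fun v : ℕ → ℝ => prev v n ^ 16 + (v n - m) ^ 16) (iidLaw σ) :=
    fun n => (hp n).1.add (integrable_coord hc n)
  have hle : ∀ n (v : ℕ → ℝ), (prev v n * (v n - m)) ^ 8 ≤ prev v n ^ 16 + (v n - m) ^ 16 :=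
    fun n v => by
      have := two_mul_le_add_sq (prev v n ^ 8) ((v n - m) ^ 8)
      have h0 : 0 ≤ prev v n ^ 8 * (v n - m) ^ 8 := by positivity
      rw [mul_pow]
      nlinarith
  have hm : ∀ n, Measurable fun v : ℕ → ℝ => prev v n * (v n - m) := fun n =>
    (hprev n).mul (by fun_prop)
  have hint : ∀ n, Integrable (fun v : ℕ → ℝ => (prev v n * (v n - m)) ^ 8) (iidLaw σ) := fun n =>
    (hb n).mono' ((hm n).pow_const 8).aestronglyMeasurable (ae_of_all _ fun v => by
      rw [Real.norm_of_nonneg (by positivity)]; exact hle n v)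
  refine tendsto_average_of_adapted (C := ∫ y, y ^ 16 ∂σ + ∫ y, (y - m) ^ 16 ∂σ) hm hint
    (fun n => ?_) (fun i j hij v y => ?_) fun n v => ?_
  · have h0 : 0 ≤ ∫ y, y ^ 16 ∂σ := integral_nonneg fun y => by positivity
    have h0' : 0 ≤ ∫ y, (y - m) ^ 16 ∂σ := integral_nonneg fun y => by positivity
    calc ∫ v, (prev v n * (v n - m)) ^ 8 ∂(iidLaw σ)
        ≤ ∫ v, (prev v n ^ 16 + (v n - m) ^ 16) ∂(iidLaw σ) :=
          integral_mono (hint n) (hb n) (hle n)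
      _ = ∫ v, prev v n ^ 16 ∂(iidLaw σ) + ∫ y, (y - m) ^ 16 ∂σ := by
          rw [integral_add (hp n).1 (integrable_coord hc n), integral_coord hc n]
      _ ≤ ∫ y, y ^ 16 ∂σ + ∫ y, (y - m) ^ 16 ∂σ := by linarith [(hp n).2]
      _ ≤ _ := le_mul_of_one_le_right (by positivity) (by linarith [n.cast_nonneg (α := ℝ)])
  · rw [prev_update hij.le, Function.update_of_ne hij.ne]
  · simp only [prev_update le_rfl, Function.update_self]
    rw [integral_const_mul, integral_sub h1 (integrable_const _)]
    simp [m]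

/-! ### Averages over the arrivals -/

lemma server_update (s : ℕ → ℝ) {i j : ℕ} (hij : i ≤ j) (x : ℕ → ℝ) (y : ℝ) :
    server (Function.update x j y) s i = server x s i := by
  induction i with
  | zero => rfl
  | succ i ih =>
    rw [server, server, ih (by omega), Function.update_of_ne (show i ≠ j by omega)]

lemma measurable_server (s : ℕ → ℝ) (n : ℕ) : Measurable fun x : ℕ → ℝ => server x s n := by
  induction n with
  | zero => exact measurable_const
  | succ n ih =>
    simp only [server]
    refine Measurable.ite (measurableSet_le ih.fst (measurable_pi_apply n)) ?_ ?_
    · exact ((Measurable.of_discrete (f := s)).comp ih.snd).prodMk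
        ((Measurable.of_discrete (f := fun k : ℕ => k + 1)).comp ih.snd)
    · exact (ih.fst.sub (measurable_pi_apply n)).prodMk ih.snd

/-- By the memoryless property, the idle time found by an arrival is, when the arrival is
successful, independent of the past of the queue.  Hence centred functions of it average out, even
when they are weighted by a function of the number of past successes. -/
lemma ae_averageVanishes {lam : ℝ} (hlam : 0 < lam) [IsProbabilityMeasure (expMeasure lam)]
    {s : ℕ → ℝ} (hs : ∀ k, 0 ≤ s k) {g : ℕ → ℝ} {B : ℝ} (hg : ∀ k : ℕ, g k ^ 8 ≤ B * (k + 1))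
    {φ : ℝ → ℝ} (hφm : Measurable φ) (hφi : Integrable φ (expMeasure lam))
    (hφ : ∀ w y, 0 ≤ w → w ≤ y → |φ w| ≤ 1 + y ^ 2) :
    ∀ᵐ x ∂(iidLaw (expMeasure lam)),
      AverageVanishes x s (fun w => φ w - ∫ y, φ y ∂(expMeasure lam)) g := by
  set e := ∫ y, φ y ∂(expMeasure lam)
  have hB : 0 ≤ B := by
    have := hg 0
    simp at this
    exact le_trans (by positivity) this
  have hpoly : Integrable (fun y : ℝ => ((1 + |e|) + 1 * y ^ 2) ^ 8) (expMeasure lam) :=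
    integrable_const_add_pow (integrable_pow_expMeasure hlam) _ _ _ _
  set M := ∫ y : ℝ, ((1 + |e|) + 1 * y ^ 2) ^ 8 ∂(expMeasure lam)
  set D : ℕ → (ℕ → ℝ) → ℝ := fun n x => if (server x s n).1 ≤ x n then
    (φ (x n - (server x s n).1) - e) * g (server x s n).2 else 0 with hD
  have hm : ∀ n, Measurable (D n) := fun n => by
    have h := measurable_server s n
    refine Measurable.ite (measurableSet_le h.fst (measurable_pi_apply n)) ?_ measurable_const
    exact ((hφm.comp ((measurable_pi_apply n).sub h.fst)).sub_const e).mul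
      ((Measurable.of_discrete (f := g)).comp h.snd)
  have hle : ∀ n x, D n x ^ 8 ≤ ((1 + |e|) + 1 * x n ^ 2) ^ 8 * (B * (n + 1)) := fun n x => by
    simp only [hD]
    split_ifs with h
    · have h1 : |φ (x n - (server x s n).1) - e| ≤ (1 + |e|) + 1 * x n ^ 2 := by
        have h2 := hφ (x n - (server x s n).1) (x n) (by linarith)
          (by linarith [server_nonneg (x := x) hs n])
        linarith [abs_sub (φ (x n - (server x s n).1)) e]
      have h3 : (φ (x n - (server x s n).1) - e) ^ 8 ≤ ((1 + |e|) + 1 * x n ^ 2) ^ 8 := by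
        rw [← Even.pow_abs (by decide : Even 8)]
        gcongr
      have h4 : ((server x s n).2 : ℝ) ≤ n := by exact_mod_cast server_count_le n
      rw [mul_pow]
      have h5 : g (server x s n).2 ^ 8 ≤ B * (n + 1) :=
        (hg _).trans (by gcongr)
      exact mul_le_mul h3 h5 (by positivity) (by positivity)
    · rw [zero_pow (by norm_num)]; positivity
  have hb : ∀ n, Integrable (fun x : ℕ → ℝ => ((1 + |e|) + 1 * x n ^ 2) ^ 8 * (B * (n + 1)))
      (iidLaw (expMeasure lam)) := fun n => (integrable_coord hpoly n).mul_const _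
  have hint : ∀ n, Integrable (fun x => D n x ^ 8) (iidLaw (expMeasure lam)) := fun n =>
    (hb n).mono' ((hm n).pow_const 8).aestronglyMeasurable (ae_of_all _ fun v => by
      rw [Real.norm_of_nonneg (by positivity)]; exact hle n v)
  refine tendsto_average_of_adapted (D := D) (C := M * B) hm hint
    (fun n => ?_) (fun i j hij x y => ?_) fun n x => ?_
  · calc ∫ x, D n x ^ 8 ∂(iidLaw (expMeasure lam))
        ≤ ∫ x, ((1 + |e|) + 1 * x n ^ 2) ^ 8 * (B * (n + 1)) ∂(iidLaw (expMeasure lam)) :=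
          integral_mono (hint n) (hb n) (hle n)
      _ = M * B * (n + 1) := by
          rw [integral_mul_const, integral_coord hpoly n]; ring
  · simp only [hD, server_update s hij.le, Function.update_of_ne hij.ne]
  · simp only [hD, server_update s le_rfl, Function.update_self]
    exact integral_overshoot_centred hlam (server_nonneg hs n) hφi _

/-- Almost every sample path of the arrivals and the services is typical. -/
lemma ae_isTypical {lam : ℝ} (hlam : 0 < lam) [IsProbabilityMeasure (expMeasure lam)]
    {σ : Measure ℝ} [IsProbabilityMeasure σ] (hσpos : ∀ᵐ y ∂σ, 0 < y)
    (hσ : ∀ k : ℕ, Integrable (fun y => y ^ k) σ) :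
    ∀ᵐ s ∂(iidLaw σ), ∀ᵐ x ∂(iidLaw (expMeasure lam)),
      IsTypical x s (1 / lam) (2 / lam ^ 2) (∫ y, y ∂σ) (∫ y, y ^ 2 ∂σ) := by
  have h1 : Integrable (fun y : ℝ => y) σ := by simpa using hσ 1
  have hE1 : Integrable (fun y : ℝ => y) (expMeasure lam) := by
    simpa using integrable_pow_expMeasure hlam 1
  have hE2 := integrable_pow_expMeasure hlam 2
  filter_upwards [ae_forall_coord hσpos, tendsto_average_iid (f := fun y => y) (by fun_prop) h1,
    tendsto_average_iid (f := fun y => y ^ 2) (by fun_prop) (hσ 2), ae_service_mul_average hσ,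
    ae_growth (hσ 8)] with s hpos havg hsq hmul hgrow
  have hs0 : ∀ k, 0 ≤ s k := fun k => (hpos k).le
  obtain ⟨B, hB, hgB⟩ := hgrow
  have hprev : ∀ k : ℕ, prev s k ^ 8 ≤ B * (k + 1) := fun k => by
    cases k with
    | zero => simp [prev]; positivity
    | succ k =>
      refine (hgB k).trans ?_
      push_cast
      nlinarith
  have hone : ∀ k : ℕ, (1 : ℝ) ^ 8 ≤ 1 * (k + 1) := fun k => by
    have : (0 : ℝ) ≤ k := k.cast_nonneg
    linarith
  have hφ1 : ∀ w y : ℝ, 0 ≤ w → w ≤ y → |w| ≤ 1 + y ^ 2 := fun w y hw hwy => by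
    rw [abs_of_nonneg hw]; nlinarith [sq_nonneg (y - 1), sq_nonneg y]
  have hφ2 : ∀ w y : ℝ, 0 ≤ w → w ≤ y → |w ^ 2| ≤ 1 + y ^ 2 := fun w y hw hwy => by
    rw [abs_of_nonneg (by positivity)]; nlinarith
  have hidle := fun (g : ℕ → ℝ) (B : ℝ) (hg : ∀ k : ℕ, g k ^ 8 ≤ B * (k + 1)) =>
    ae_averageVanishes hlam hs0 hg (φ := fun w => w) measurable_id hE1 hφ1
  simp only [integral_id_expMeasure hlam] at hidle
  have hidle2 := ae_averageVanishes hlam hs0 hone (φ := fun w => w ^ 2) (by fun_prop) hE2 hφ2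
  simp only [integral_sq_expMeasure hlam] at hidle2
  have hxavg := tendsto_average_iid (f := fun y => y) (by fun_prop) hE1
  rw [integral_id_expMeasure hlam] at hxavg
  filter_upwards [ae_forall_coord (ae_pos_expMeasure lam), hxavg,
    ae_growth (integrable_pow_expMeasure hlam 8), hidle (fun _ => 1) 1 hone, hidle2,
    hidle s B hgB, hidle (prev s) B hprev] with x hx hxavg hxg i1 i2 i3 i4
  refine ⟨hx, hpos, hxavg, hxg, havg, hsq, tendsto_prev_average havg, ?_, ⟨B, hB, hgB⟩, i1, i2,
    i3, i4⟩
  have := hmul.add ((tendsto_prev_average havg).mul_const (∫ y, y ∂σ))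
  rw [zero_add, ← pow_two] at this
  refine this.congr fun n => ?_
  rw [div_mul_eq_mul_div, ← add_div, Finset.sum_mul, ← Finset.sum_add_distrib]
  congr 1
  exact Finset.sum_congr rfl fun i _ => by ring

/-! ### Sampling at Poisson epochs -/

lemma sum_update_of_le {i j : ℕ} (hij : i ≤ j) (z : ℕ → ℝ) (y : ℝ) :
    ∑ k ∈ Finset.range i, Function.update z j y k = ∑ k ∈ Finset.range i, z k :=
  Finset.sum_congr rfl fun k hk =>
    Function.update_of_ne (by have := Finset.mem_range.1 hk; omega) _ _

/-- Poisson arrivals see time averages: the values of a slowly growing function at the epochs of a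
Poisson process have the same long-run average as the function itself. -/
theorem ae_tendsto_poisson_average {nu : ℝ} (hnu : 0 < nu) [IsProbabilityMeasure (expMeasure nu)]
    {f : ℝ → ℝ} (hf : Measurable f) {A c : ℝ} (hA : 0 ≤ A)
    (hgrowth : ∀ t, |f t| ^ 8 ≤ A * (1 + |t|))
    (havg : Tendsto (fun t : ℝ => (∫ u in (0 : ℝ)..t, f u) / t) atTop (𝓝 c)) :
    ∀ᵐ z ∂(iidLaw (expMeasure nu)),
      Tendsto (fun n : ℕ => (∑ j ∈ Finset.range n, f (epoch z j)) / n) atTop (𝓝 c) := by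
  set E := expMeasure nu
  have hlin : ∀ t, |f t| ≤ 1 + A * (1 + |t|) := fun t => by
    refine le_trans ?_ (add_le_add_right (hgrowth t) 1)
    rcases le_total |f t| 1 with h | h
    · have : 0 ≤ |f t| ^ 8 := by positivity
      linarith
    · have := le_self_pow₀ h (by norm_num : 8 ≠ 0)
      linarith
  have hcont : Continuous fun t : ℝ => 1 + A * (1 + |t|) := by fun_prop
  have hloc : ∀ a b, IntervalIntegrable f volume a b := fun a b =>
    (hcont.intervalIntegrable a b).mono_fun
      hf.aestronglyMeasurable (ae_of_all _ fun t => by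
        simpa using (hlin t).trans (le_abs_self _))
  set F : ℝ → ℝ := fun t => ∫ u in (0 : ℝ)..t, f u with hF
  have hFc : Continuous F := intervalIntegral.continuous_primitive hloc 0
  have hFsub : ∀ a b, F b - F a = ∫ u in a..b, f u := fun a b =>
    intervalIntegral.integral_interval_sub_left (hloc 0 b) (hloc 0 a)
  set τ : ℕ → (ℕ → ℝ) → ℝ := fun n z => ∑ i ∈ Finset.range n, z i with hτ
  have hτm : ∀ n, Measurable (τ n) := fun n =>
    Finset.measurable_fun_sum _ fun i _ => measurable_pi_apply i
  set D : ℕ → (ℕ → ℝ) → ℝ := fun n z =>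
    f (τ (n + 1) z) - nu * (F (τ (n + 1) z) - F (τ n z)) with hD
  have hDm : ∀ n, Measurable (D n) := fun n =>
    (hf.comp (hτm _)).sub (((hFc.measurable.comp (hτm _)).sub
      (hFc.measurable.comp (hτm _))).const_mul nu)
  have hpos : ∀ᵐ z ∂(iidLaw E), ∀ i, 0 < z i := ae_forall_coord (ae_pos_expMeasure nu)
  -- `|D n z|` is at most `(A * (1 + t)) ^ (1 / 8) * (1 + nu * z n)` with `t = z 0 + ⋯ + z n`; in the
  -- eighth power of this bound, `z i * Y (z n) ≤ z i ^ 2 + Y (z n) ^ 2` separates the variables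
  set Y : ℝ → ℝ := fun y => (1 + nu * y ^ 1) ^ 8 with hY
  have hYi : Integrable Y E := integrable_const_add_pow (integrable_pow_expMeasure hnu) _ _ _ _
  have hY2i : Integrable (fun y => Y y ^ 2) E := by
    simp only [hY, ← pow_mul]
    exact integrable_const_add_pow (integrable_pow_expMeasure hnu) _ _ _ _
  have hz2i : Integrable (fun y : ℝ => y ^ 2) E := integrable_pow_expMeasure hnu 2
  set G : ℕ → (ℕ → ℝ) → ℝ := fun n z =>
    A * (Y (z n) + ∑ i ∈ Finset.range (n + 1), (z i ^ 2 + Y (z n) ^ 2)) with hG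
  have hGi : ∀ n, Integrable (G n) (iidLaw E) := fun n =>
    ((integrable_coord hYi n).add (integrable_finsetSum _ fun i _ =>
      (integrable_coord hz2i i).add (integrable_coord hY2i n))).const_mul A
  have hDG : ∀ n, ∀ᵐ z ∂(iidLaw E), D n z ^ 8 ≤ G n z := fun n => by
    filter_upwards [hpos] with z hz
    have hτ0 : 0 ≤ τ n z := Finset.sum_nonneg fun i _ => (hz i).le
    have hτs : τ (n + 1) z = τ n z + z n := Finset.sum_range_succ _ _
    have hle : τ n z ≤ τ (n + 1) z := by rw [hτs]; linarith [hz n]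
    set K := A * (1 + τ (n + 1) z) with hK
    have hK0 : 0 ≤ K := mul_nonneg hA (by linarith)
    have hroot : ∀ t, 0 ≤ t → t ≤ τ (n + 1) z → |f t| ≤ K ^ (1 / 8 : ℝ) := fun t h0 h1 => by
      have h2 : |f t| ^ 8 ≤ K := (hgrowth t).trans (by
        rw [abs_of_nonneg h0]
        exact mul_le_mul_of_nonneg_left (by linarith) hA)
      calc |f t| = (|f t| ^ 8) ^ (1 / 8 : ℝ) := by
            rw [← Real.rpow_natCast, ← Real.rpow_mul (abs_nonneg _)]; norm_num
        _ ≤ K ^ (1 / 8 : ℝ) := Real.rpow_le_rpow (by positivity) h2 (by norm_num)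
    have hint : |F (τ (n + 1) z) - F (τ n z)| ≤ K ^ (1 / 8 : ℝ) * z n := by
      rw [hFsub]
      have := intervalIntegral.norm_integral_le_of_norm_le_const (a := τ n z) (b := τ (n + 1) z)
        (f := f) (C := K ^ (1 / 8 : ℝ)) fun t ht => by
          rw [Set.uIoc_of_le hle] at ht
          exact hroot t (hτ0.trans ht.1.le) ht.2
      rwa [Real.norm_eq_abs, hτs, add_sub_cancel_left, abs_of_pos (hz n), ← hτs] at this
    have hDle : |D n z| ≤ K ^ (1 / 8 : ℝ) * (1 + nu * z n) := by
      have h1 := hroot _ (hτ0.trans hle) le_rfl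
      have h2 : |nu * (F (τ (n + 1) z) - F (τ n z))| ≤ nu * (K ^ (1 / 8 : ℝ) * z n) := by
        rw [abs_mul, abs_of_pos hnu]; gcongr
      have h3 := abs_sub (f (τ (n + 1) z)) (nu * (F (τ (n + 1) z) - F (τ n z)))
      calc |D n z| ≤ _ := h3
        _ ≤ K ^ (1 / 8 : ℝ) + nu * (K ^ (1 / 8 : ℝ) * z n) := add_le_add h1 h2
        _ = _ := by ring
    have hK8 : (K ^ (1 / 8 : ℝ)) ^ 8 = K := by
      rw [← Real.rpow_natCast, ← Real.rpow_mul hK0]; norm_num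
    have hY0 : 0 ≤ Y (z n) := by positivity
    calc D n z ^ 8 = |D n z| ^ 8 := (Even.pow_abs (by decide) _).symm
      _ ≤ (K ^ (1 / 8 : ℝ) * (1 + nu * z n)) ^ 8 := by gcongr
      _ = A * (Y (z n) + ∑ i ∈ Finset.range (n + 1), z i * Y (z n)) := by
          rw [mul_pow, hK8, hK, ← Finset.sum_mul]
          simp only [hY, hτ, pow_one]
          ring
      _ ≤ G n z := by
          simp only [hG]
          gcongr with i hi
          nlinarith [two_mul_le_add_sq (z i) (Y (z n)), mul_nonneg (hz i).le hY0]
  have hDi : ∀ n, Integrable (fun z => D n z ^ 8) (iidLaw E) := fun n =>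
    (hGi n).mono' ((hDm n).pow_const 8).aestronglyMeasurable (by
      filter_upwards [hDG n] with z hz
      rwa [Real.norm_of_nonneg (by positivity)])
  have hy0 : 0 ≤ ∫ y, Y y ∂E := integral_nonneg_of_ae (by
    filter_upwards with y
    have : Even 8 := by decide
    exact this.pow_nonneg _)
  have hmain : ∀ᵐ z ∂(iidLaw E),
      Tendsto (fun n : ℕ => (∑ j ∈ Finset.range n, D j z) / n) atTop (𝓝 0) := by
    refine tendsto_average_of_adapted
      (C := A * (∫ y, Y y ∂E + (∫ y, y ^ 2 ∂E + ∫ y, Y y ^ 2 ∂E))) hDm hDi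
      (fun n => ?_) (fun i j hij z y => ?_) fun n z => ?_
    · calc ∫ z, D n z ^ 8 ∂(iidLaw E) ≤ ∫ z, G n z ∂(iidLaw E) :=
            integral_mono_ae (hDi n) (hGi n) (hDG n)
        _ = A * (∫ y, Y y ∂E + (n + 1) * (∫ y, y ^ 2 ∂E + ∫ y, Y y ^ 2 ∂E)) := by
            have hs : ∀ i, Integrable (fun z : ℕ → ℝ => z i ^ 2 + Y (z n) ^ 2) (iidLaw E) :=
              fun i => (integrable_coord hz2i i).add (integrable_coord hY2i n)
            simp only [hG]
            rw [integral_const_mul, integral_add (integrable_coord hYi n)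
              (integrable_finsetSum _ fun i _ => hs i), integral_finsetSum _ fun i _ => hs i,
              integral_coord hYi n]
            have he : ∀ i, ∫ z : ℕ → ℝ, (z i ^ 2 + Y (z n) ^ 2) ∂(iidLaw E)
                = ∫ y, y ^ 2 ∂E + ∫ y, Y y ^ 2 ∂E := fun i => by
              rw [integral_add (integrable_coord hz2i i) (integrable_coord hY2i n),
                integral_coord hz2i i, integral_coord hY2i n]
            simp only [he, Finset.sum_const, Finset.card_range, nsmul_eq_mul]
            push_cast
            rfl
        _ ≤ _ := by
            have hn : (0 : ℝ) ≤ n := n.cast_nonneg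
            have h1 : ∫ y, Y y ∂E ≤ (n + 1) * ∫ y, Y y ∂E :=
              le_mul_of_one_le_left hy0 (by linarith)
            rw [mul_assoc]
            refine mul_le_mul_of_nonneg_left ?_ hA
            linarith
    · simp only [hD, hτ, sum_update_of_le (show i + 1 ≤ j from hij), sum_update_of_le hij.le]
    · have hup : ∀ y, τ (n + 1) (Function.update z n y) = τ n z + y := fun y => by
        simp only [hτ, Finset.sum_range_succ, sum_update_of_le le_rfl, Function.update_self]
      have hup' : ∀ y, τ n (Function.update z n y) = τ n z := fun y => sum_update_of_le le_rfl z y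
      simp only [hD, hup, hup']
      have hb : Measurable fun u => f (τ n z + u) := hf.comp (measurable_const_add _)
      have hbi : Integrable (fun u => f (τ n z + u)) E := by
        have hid : Integrable (fun u : ℝ => |u|) E := by
          simpa using (integrable_pow_expMeasure hnu 1).abs
        refine Integrable.mono' (g := fun u => (1 + A * (1 + |τ n z|)) + A * |u|)
          ((integrable_const _).add (hid.const_mul A)) hb.aestronglyMeasurable
          (ae_of_all _ fun u => ?_)
        refine (hlin _).trans ?_
        have := mul_le_mul_of_nonneg_left (abs_add_le (τ n z) u) hA
        linarith
      have h := integral_compensator_expMeasure hnu hb hbi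
      convert! h using 5 with y
      rw [hFsub, intervalIntegral.integral_comp_add_left, add_zero]
  have hzavg := tendsto_average_iid (μ := E) (f := fun y => y) (by fun_prop)
    (by simpa using integrable_pow_expMeasure hnu 1)
  have hmean : ∫ y, y ∂E = 1 / nu := integral_id_expMeasure hnu
  rw [hmean] at hzavg
  filter_upwards [hmain, hpos, hzavg] with z h0 hz hzavg
  have hτtop : Tendsto (fun n => τ n z) atTop atTop := by
    refine (tendsto_natCast_atTop_atTop.atTop_mul_pos (by positivity : 0 < 1 / nu) hzavg).congr' ?_
    filter_upwards [eventually_gt_atTop 0] with n hn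
    have : (n : ℝ) ≠ 0 := by exact_mod_cast hn.ne'
    simp only [hτ]
    field_simp
  have h1 := h0.add (((havg.comp hτtop).mul hzavg).const_mul nu)
  have e : 0 + nu * (c * (1 / nu)) = c := by field_simp; ring
  rw [e] at h1
  refine h1.congr' ?_
  filter_upwards [eventually_gt_atTop 0, hτtop.eventually_gt_atTop 0] with n hn hτn
  have hn' : (n : ℝ) ≠ 0 := by exact_mod_cast hn.ne'
  have hF0 : F 0 = 0 := intervalIntegral.integral_same
  have hsum : ∑ j ∈ Finset.range n, D j z
      = ∑ j ∈ Finset.range n, f (epoch z j) - nu * F (τ n z) := by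
    simp only [hD, Finset.sum_sub_distrib, ← Finset.mul_sum]
    have := Finset.sum_range_sub (fun j => F (τ j z)) n
    rw [Finset.sum_sub_distrib] at this
    rw [this]
    simp [hτ, hF0, epoch]
  rw [hsum]
  have hτn' : τ n z ≠ 0 := hτn.ne'
  change _ + nu * (F (τ n z) / τ n z * (τ n z / n)) = _
  field_simp
  ring

/-! ### Measurability of the age -/

lemma measurable_sInf_nat {α : Type*} [MeasurableSpace α] {p : ℕ → α → Prop}
    (hp : ∀ n, MeasurableSet {a | p n a}) : Measurable fun a => sInf {n : ℕ | p n a} := by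
  classical
  have hex : ∀ a, ∃ n, p n a ∨ ∀ k, ¬ p k a := fun a => by
    by_cases h : ∃ n, p n a
    · exact ⟨h.choose, Or.inl h.choose_spec⟩
    · exact ⟨0, Or.inr (not_exists.1 h)⟩
  have e : (fun a => sInf {n : ℕ | p n a}) = fun a => Nat.find (hex a) := by
    funext a
    by_cases h : ∃ n, p n a
    · have hne : {n : ℕ | p n a}.Nonempty := h
      have hnot : ¬ ∀ k, ¬ p k a := by simpa using h
      refine le_antisymm (Nat.sInf_le ?_) (Nat.find_le (Or.inl (Nat.sInf_mem hne)))
      exact (Nat.find_spec (hex a)).resolve_right hnot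
    · have h' := not_exists.1 h
      have hemp : {n : ℕ | p n a} = ∅ := by ext n; simp [h' n]
      rw [hemp, Nat.sInf_empty]
      exact ((Nat.find_eq_zero (hex a)).2 (Or.inr h')).symm
  rw [e]
  refine measurable_find hex fun n => ?_
  have : {a | p n a ∨ ∀ k, ¬ p k a} = {a | p n a} ∪ ⋂ k, {a | p k a}ᶜ := by ext; simp
  rw [this]
  exact (hp n).union (MeasurableSet.iInter fun k => (hp k).compl)

section Measurability

variable {α : Type*} [MeasurableSpace α] {X S : α → ℕ → ℝ} {τ : α → ℝ}

lemma measurable_epoch (hX : Measurable X) (n : ℕ) : Measurable fun a => epoch (X a) n :=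
  Finset.measurable_fun_sum _ fun i _ => (measurable_pi_apply i).comp hX

lemma measurable_apply_nat {f : α → ℕ → ℝ} (hf : ∀ n, Measurable fun a => f a n) {N : α → ℕ}
    (hN : Measurable N) : Measurable fun a => f a (N a) := by
  have h : Measurable fun q : ℕ × α => f q.2 q.1 := measurable_from_prod_countable_right hf
  exact h.comp (hN.prodMk measurable_id)

lemma measurable_successIndex (hX : Measurable X) (hS : Measurable S) (k : ℕ) :
    Measurable fun a => successIndex (X a) (S a) k := by
  induction k with
  | zero => exact measurable_const
  | succ k ih =>
    simp only [successIndex]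
    refine measurable_sInf_nat fun n => ?_
    refine (measurableSet_lt ih measurable_const).inter (measurableSet_le ?_ (measurable_epoch hX n))
    exact (measurable_apply_nat (measurable_epoch hX) ih).add ((measurable_pi_apply k).comp hS)

lemma measurable_arrivalTime (hX : Measurable X) (hS : Measurable S) (k : ℕ) :
    Measurable fun a => arrivalTime (X a) (S a) k :=
  measurable_apply_nat (measurable_epoch hX) (measurable_successIndex hX hS k)

lemma measurableSet_departureTime_le (hX : Measurable X) (hS : Measurable S) (hτ : Measurable τ)
    (k : ℕ) : MeasurableSet {a | departureTime (X a) (S a) k ≤ τ a} :=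
  measurableSet_le ((measurable_arrivalTime hX hS k).add ((measurable_pi_apply k).comp hS)) hτ

lemma measurable_latestReceived (hX : Measurable X) (hS : Measurable S) (hτ : Measurable τ) :
    Measurable fun a => latestReceived (X a) (S a) (τ a) := by
  -- the supremum of a set of natural numbers is the infimum of its upper bounds,
  -- also when the set is unbounded and both are `0`
  have hsup : ∀ s : Set ℕ, sSup s = sInf (upperBounds s) := fun s => by
    by_cases hs : BddAbove s
    · rcases s.eq_empty_or_nonempty with rfl | hne
      · simp
      · exact (csInf_upperBounds_eq_csSup hs hne).symm
    · have : upperBounds s = ∅ := Set.not_nonempty_iff_eq_empty.1 hs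
      rw [this, Nat.sInf_empty, Nat.sSup_of_not_bddAbove hs]
  simp only [latestReceived, hsup]
  refine measurable_sInf_nat (p := fun n a => n ∈ upperBounds {k | departureTime (X a) (S a) k ≤ τ a})
    fun n => ?_
  have : {a | n ∈ upperBounds {k | departureTime (X a) (S a) k ≤ τ a}}
      = ⋂ k, {a | departureTime (X a) (S a) k ≤ τ a}ᶜ ∪ {_a | k ≤ n} := by
    ext a
    simp [mem_upperBounds, imp_iff_not_or]
  rw [this]
  exact MeasurableSet.iInter fun k =>
    (measurableSet_departureTime_le hX hS hτ k).compl.union (MeasurableSet.const _)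

lemma measurable_age (hX : Measurable X) (hS : Measurable S) (hτ : Measurable τ) :
    Measurable fun a => age (X a) (S a) (τ a) := by
  classical
  simp only [age]
  refine Measurable.ite ?_ (hτ.sub (measurable_apply_nat (measurable_arrivalTime hX hS)
    (measurable_latestReceived hX hS hτ))) hτ
  have : {a | ∃ k, departureTime (X a) (S a) k ≤ τ a}
      = ⋃ k, {a | departureTime (X a) (S a) k ≤ τ a} := by ext; simp
  rw [this]
  exact MeasurableSet.iUnion (measurableSet_departureTime_le hX hS hτ)

end Measurability

/-! ### From the product of the path spaces to the random system -/

/-- The law of a family of independent variables indexed by a disjoint union is the product of the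
laws of the two subfamilies. -/
lemma measurePreserving_sumElim {ι κ : Type*} {μ : ι → Measure ℝ} {ν : κ → Measure ℝ}
    [∀ i, IsProbabilityMeasure (μ i)] [∀ i, IsProbabilityMeasure (ν i)]
    [∀ i, IsProbabilityMeasure (Sum.elim μ ν i)] :
    MeasurePreserving (fun p : (ι → ℝ) × (κ → ℝ) => (Sum.elim p.1 p.2 : ι ⊕ κ → ℝ))
      ((Measure.infinitePi μ).prod (Measure.infinitePi ν))
      (Measure.infinitePi (Sum.elim μ ν)) := by
  have hm : Measurable fun p : (ι → ℝ) × (κ → ℝ) => (Sum.elim p.1 p.2 : ι ⊕ κ → ℝ) := by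
    refine measurable_pi_iff.2 fun i => ?_
    cases i with
    | inl i => exact (measurable_pi_apply i).comp measurable_fst
    | inr i => exact (measurable_pi_apply i).comp measurable_snd
  refine ⟨hm, Measure.eq_infinitePi _ fun s t ht => ?_⟩
  rw [Measure.map_apply hm (MeasurableSet.pi s.countable_toSet fun i _ => ht i)]
  have e : (fun p : (ι → ℝ) × (κ → ℝ) => (Sum.elim p.1 p.2 : ι ⊕ κ → ℝ)) ⁻¹' ((s : Set (ι ⊕ κ)).pi t)
      = ((s.toLeft : Set ι).pi fun i => t (Sum.inl i)) ×ˢ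
        ((s.toRight : Set κ).pi fun i => t (Sum.inr i)) := by
    ext ⟨v, w⟩
    simp only [Set.mem_preimage, Set.mem_pi, Set.mem_prod, Finset.mem_coe, Finset.mem_toLeft,
      Finset.mem_toRight, Sum.forall, Sum.elim_inl, Sum.elim_inr]
  rw [e, Measure.prod_prod, Measure.infinitePi_pi _ (fun i _ => ht _),
    Measure.infinitePi_pi _ (fun i _ => ht _)]
  conv_rhs => rw [← Finset.toLeft_disjSum_toRight (u := s), Finset.prod_disjSum]
  simp

/-- Properties of almost all triples of independent paths hold almost surely for the system. -/
lemma IsMG11M.ae_of_ae {Ω : Type*} [MeasurableSpace Ω] {P : Measure Ω} [IsProbabilityMeasure P]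
    {lam nu : ℝ} [IsProbabilityMeasure (expMeasure lam)] [IsProbabilityMeasure (expMeasure nu)]
    {σ : Measure ℝ} [IsProbabilityMeasure σ] {X S Z : ℕ → Ω → ℝ} (h : IsMG11M P lam nu σ X S Z)
    {p : (ℕ → ℝ) × (ℕ → ℝ) × (ℕ → ℝ) → Prop} (hpm : MeasurableSet {q | p q})
    (hp : ∀ᵐ q ∂((iidLaw σ).prod ((iidLaw (expMeasure lam)).prod (iidLaw (expMeasure nu)))), p q) :
    ∀ᵐ ω ∂P, p (fun n => S n ω, fun n => X n ω, fun n => Z n ω) := by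
  set law : ℕ ⊕ (ℕ ⊕ ℕ) → Measure ℝ :=
    Sum.elim (fun _ => σ) (Sum.elim (fun _ => expMeasure lam) fun _ => expMeasure nu) with hlaw
  have h2 : ∀ i, IsProbabilityMeasure (Sum.elim (fun _ : ℕ => expMeasure lam)
      (fun _ : ℕ => expMeasure nu) i) := by
    rintro (i | i) <;> simp only [Sum.elim_inl, Sum.elim_inr] <;> infer_instance
  have h3 : ∀ i, IsProbabilityMeasure (law i) := by
    rintro (i | i | i) <;> simp only [hlaw, Sum.elim_inl, Sum.elim_inr] <;> infer_instance
  set V : ℕ ⊕ (ℕ ⊕ ℕ) → Ω → ℝ := Sum.elim S (Sum.elim X Z)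
  have hind : iIndepFun V P := by
    have hinj : Function.Injective
        (Sum.elim (Sum.inr ∘ Sum.inl) (Sum.elim Sum.inl (Sum.inr ∘ Sum.inr)) :
          ℕ ⊕ (ℕ ⊕ ℕ) → ℕ ⊕ (ℕ ⊕ ℕ)) := by
      rintro (i | i | i) (j | j | j) <;> simp
    have := h.indep.precomp hinj
    convert! this using 1
    funext i
    rcases i with i | i | i <;> rfl
  have hlawV : ∀ i, HasLaw (V i) (law i) P := by
    rintro (i | i | i)
    · exact h.law_service i
    · exact h.law_arrival i
    · exact h.law_decision i
  have hjoint : HasLaw (fun ω i => V i ω) (Measure.infinitePi law) P :=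
    hind.hasLaw_infinitePi hlawV (aemeasurable_pi_iff.2 fun i => (hlawV i).aemeasurable)
  -- read the three paths off the joint family
  set π : (ℕ ⊕ (ℕ ⊕ ℕ) → ℝ) → (ℕ → ℝ) × (ℕ → ℝ) × (ℕ → ℝ) := fun v =>
    (fun n => v (Sum.inl n), fun n => v (Sum.inr (Sum.inl n)), fun n => v (Sum.inr (Sum.inr n)))
    with hπ
  have hπm : Measurable π := by
    refine Measurable.prodMk ?_ (Measurable.prodMk ?_ ?_) <;>
      exact measurable_pi_iff.2 fun n => measurable_pi_apply _
  have hprod : MeasurePreserving (fun q : (ℕ → ℝ) × (ℕ → ℝ) × (ℕ → ℝ) =>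
        (Sum.elim q.1 (Sum.elim q.2.1 q.2.2) : ℕ ⊕ (ℕ ⊕ ℕ) → ℝ))
      ((iidLaw σ).prod ((iidLaw (expMeasure lam)).prod (iidLaw (expMeasure nu))))
      (Measure.infinitePi law) :=
    measurePreserving_sumElim.comp ((MeasurePreserving.id _).prod measurePreserving_sumElim)
  have hae : ∀ᵐ v ∂(Measure.infinitePi law), p (π v) := by
    have hpπ : MeasurableSet {v | p (π v)} := hπm hpm
    rw [← hprod.map_eq, ae_map_iff hprod.measurable.aemeasurable hpπ]
    exact hp
  rw [← hjoint.map_eq] at hae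
  exact ae_of_ae_map hjoint.aemeasurable hae

/-! ### The average age upon decisions -/

lemma tendsto_numDecisions {z : ℕ → ℝ} (hz : ∀ i, 0 < z i)
    (htop : Tendsto (epoch z) atTop atTop) : Tendsto (numDecisions z) atTop atTop := by
  have hmono : Monotone (epoch z) := monotone_nat_of_le_succ fun n => by
    rw [epoch_succ]; linarith [hz (n + 1)]
  refine tendsto_atTop.2 fun b => ?_
  filter_upwards [eventually_ge_atTop (epoch z b)] with T hT
  have hfin : {j : ℕ | epoch z j ≤ T}.Finite := by
    obtain ⟨N, hN⟩ := eventually_atTop.1 (htop.eventually_gt_atTop T)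
    refine (Set.finite_Iio N).subset fun j hj => ?_
    by_contra h
    exact absurd hj (not_le.2 (hN j (not_lt.1 h)))
  have hsub : (Finset.range (b + 1) : Set ℕ) ⊆ {j : ℕ | epoch z j ≤ T} := fun j hj => by
    have : j ≤ b := by simpa [Nat.lt_succ_iff] using hj
    exact (hmono this).trans hT
  have := Set.ncard_le_ncard hsub hfin
  rw [Set.ncard_coe_finset, Finset.card_range] at this
  exact (Nat.le_succ b).trans this

/-- The average age upon decisions in terms of the first two moments of the service times; it does
not depend on the decision rate. -/
theorem IsMG11M.hasAverageAuD {Ω : Type*} [MeasurableSpace Ω] {P : Measure Ω}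
    [IsProbabilityMeasure P] {lam nu : ℝ} (hlam : 0 < lam) (hnu : 0 < nu) {σ : Measure ℝ}
    [IsProbabilityMeasure σ] (hσpos : ∀ᵐ y ∂σ, 0 < y)
    (hσ : ∀ k : ℕ, Integrable (fun y => y ^ k) σ) {X S Z : ℕ → Ω → ℝ}
    (h : IsMG11M P lam nu σ X S Z) {m v : ℝ} (hm : ∫ y, y ∂σ = m) (hv : ∫ y, y ^ 2 ∂σ = v) :
    HasAverageAuD P X S Z
      ((m * (1 / lam + m) + (2 / lam ^ 2 + 2 * (1 / lam) * m + v) / 2) / (1 / lam + m)) := by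
  have := isProbabilityMeasure_expMeasure hlam
  have := isProbabilityMeasure_expMeasure hnu
  have ha : 0 < 1 / lam := by positivity
  set c := (m * (1 / lam + m) + (2 / lam ^ 2 + 2 * (1 / lam) * m + v) / 2) / (1 / lam + m)
  set p : (ℕ → ℝ) × (ℕ → ℝ) × (ℕ → ℝ) → Prop := fun q => (∀ i, 0 < q.2.2 i) ∧
    Tendsto (fun n : ℕ => (∑ i ∈ Finset.range n, q.2.2 i) / n) atTop (𝓝 (1 / nu)) ∧
    Tendsto (fun n : ℕ => (∑ j ∈ Finset.range n, age q.2.1 q.1 (epoch q.2.2 j)) / n) atTop (𝓝 c)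
    with hp
  have hz : Measurable fun q : (ℕ → ℝ) × (ℕ → ℝ) × (ℕ → ℝ) => q.2.2 := by fun_prop
  have hpm : MeasurableSet {q | p q} := by
    refine MeasurableSet.inter ?_ (MeasurableSet.inter ?_ ?_)
    · exact measurableSet_setOfPred.2 (Measurable.forall fun i => measurableSet_setOfPred.1
        (measurableSet_lt measurable_const ((measurable_pi_apply i).comp hz)))
    · exact measurableSet_tendsto _ fun n =>
        (Finset.measurable_fun_sum _ fun i _ => (measurable_pi_apply i).comp hz).div_const _
    · exact measurableSet_tendsto _ fun n => (Finset.measurable_fun_sum _ fun j _ =>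
        measurable_age measurable_snd.fst measurable_fst (measurable_epoch hz j)).div_const _
  have hpae : ∀ᵐ q ∂((iidLaw σ).prod
      ((iidLaw (expMeasure lam)).prod (iidLaw (expMeasure nu)))), p q := by
    rw [Measure.ae_prod_iff_ae_ae hpm]
    filter_upwards [ae_isTypical hlam hσpos hσ] with s hs
    have hps : MeasurableSet {y : (ℕ → ℝ) × (ℕ → ℝ) | p (s, y)} := measurable_prodMk_left hpm
    rw [Measure.ae_prod_iff_ae_ae hps]
    filter_upwards [hs] with x hx
    rw [hm, hv] at hx
    have hage : Measurable (age x s) :=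
      measurable_age (X := fun _ => x) (S := fun _ => s) (τ := fun t => t) measurable_const
        measurable_const measurable_id
    have hpos : Measurable (posAge x s) :=
      Measurable.ite measurableSet_Ici hage measurable_const
    obtain ⟨A, hA, hgrow⟩ := hx.posAge_growth ha
    have havg : Tendsto (fun t : ℝ => (∫ u in (0 : ℝ)..t, posAge x s u) / t) atTop (𝓝 c) := by
      refine (hx.tendsto_time_average ha).congr' ?_
      filter_upwards [eventually_ge_atTop 0] with t ht
      congr 1
      refine intervalIntegral.integral_congr fun u hu => ?_
      rw [Set.uIcc_of_le ht] at hu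
      simp [posAge, hu.1]
    have hzavg := tendsto_average_iid (μ := expMeasure nu) (f := fun y => y) (by fun_prop)
      (by simpa using integrable_pow_expMeasure hnu 1)
    rw [integral_id_expMeasure hnu] at hzavg
    filter_upwards [ae_forall_coord (ae_pos_expMeasure nu), hzavg,
      ae_tendsto_poisson_average hnu hpos hA.le hgrow havg] with z hz0 hz1 hz2
    refine ⟨hz0, hz1, hz2.congr fun n => ?_⟩
    congr 1
    refine Finset.sum_congr rfl fun j _ => ?_
    have : 0 ≤ epoch z j := Finset.sum_nonneg fun i _ => (hz0 i).le
    simp [posAge, this]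
  filter_upwards [h.ae_of_ae hpm hpae] with ω hω
  obtain ⟨hz0, hz1, hz2⟩ := hω
  have htop : Tendsto (epoch fun n => Z n ω) atTop atTop := by
    have h1 : Tendsto (fun n => ∑ i ∈ Finset.range n, Z i ω) atTop atTop := by
      refine (tendsto_natCast_atTop_atTop.atTop_mul_pos (by positivity : 0 < 1 / nu) hz1).congr' ?_
      filter_upwards [eventually_gt_atTop 0] with n hn
      have : (n : ℝ) ≠ 0 := by exact_mod_cast hn.ne'
      field_simp
    exact h1.comp (tendsto_add_atTop_nat 1)
  refine (hz2.comp (tendsto_numDecisions hz0 htop)).congr fun T => ?_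
  simp only [Function.comp_apply, empiricalAuD, ageUponDecision]
  ring

/-! ### The three service time distributions -/

lemma uniformService_eq {mu : ℝ} (hmu : 0 < mu) (f : ℝ → ℝ) :
    ∫ y, f y ∂(uniformService mu) = mu / 2 * ∫ y in (0 : ℝ)..(2 / mu), f y := by
  have h2 : 0 < 2 / mu := by positivity
  rw [uniformService, ProbabilityTheory.cond, integral_smul_measure, Real.volume_Ioo,
    intervalIntegral.integral_of_le h2.le, integral_Ioc_eq_integral_Ioo, sub_zero,
    ENNReal.toReal_inv, ENNReal.toReal_ofReal h2.le, smul_eq_mul, inv_div]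

lemma isProbabilityMeasure_uniformService {mu : ℝ} (hmu : 0 < mu) :
    IsProbabilityMeasure (uniformService mu) := by
  have h2 : 0 < 2 / mu := by positivity
  exact cond_isProbabilityMeasure_of_finite (by simpa using h2) (by simp)

lemma ae_mem_uniformService (mu : ℝ) : ∀ᵐ y ∂(uniformService mu), y ∈ Set.Ioo 0 (2 / mu) :=
  ae_cond_mem measurableSet_Ioo

lemma integrable_pow_uniformService {mu : ℝ} (hmu : 0 < mu) (k : ℕ) :
    Integrable (fun y => y ^ k) (uniformService mu) := by
  have := isProbabilityMeasure_uniformService hmu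
  refine Integrable.mono' (integrable_const ((2 / mu) ^ k)) (by fun_prop) ?_
  filter_upwards [ae_mem_uniformService mu] with y hy
  rw [Real.norm_of_nonneg (pow_nonneg hy.1.le k)]
  exact pow_le_pow_left₀ hy.1.le hy.2.le k

lemma integral_id_uniformService {mu : ℝ} (hmu : 0 < mu) :
    ∫ y, y ∂(uniformService mu) = 1 / mu := by
  rw [uniformService_eq hmu, integral_id]
  field_simp
  ring

lemma integral_sq_uniformService {mu : ℝ} (hmu : 0 < mu) :
    ∫ y, y ^ 2 ∂(uniformService mu) = 4 / (3 * mu ^ 2) := by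
  rw [uniformService_eq hmu, integral_pow, div_pow]
  field_simp
  ring

end BufferlessQueue

end

open BufferlessQueue in
theorem corollary1
    (lam mu rho nuU nuM nuD : ℝ) (hlam : 0 < lam) (hmu : 0 < mu) (hrho : rho = lam / mu)
    (hnuU : 0 < nuU) (hnuM : 0 < nuM) (hnuD : 0 < nuD)
    {ΩU ΩM ΩD : Type*} [MeasurableSpace ΩU] [MeasurableSpace ΩM] [MeasurableSpace ΩD]
    (PU : Measure ΩU) (PM : Measure ΩM) (PD : Measure ΩD)
    [IsProbabilityMeasure PU] [IsProbabilityMeasure PM] [IsProbabilityMeasure PD]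
    (XU SU ZU : ℕ → ΩU → ℝ) (XM SM ZM : ℕ → ΩM → ℝ) (XD SD ZD : ℕ → ΩD → ℝ)
    (hU : IsMG11M PU lam nuU (uniformService mu) XU SU ZU)
    (hM : IsMG11M PM lam nuM (exponentialService mu) XM SM ZM)
    (hD : IsMG11M PD lam nuD (deterministicService mu) XD SD ZD) :
    ∃ avgU avgM avgD : ℝ,
      (HasAverageAuD PU XU SU ZU avgU ∧
        avgU = (3 + 6 * rho + 5 * rho ^ 2) / (3 * lam * (1 + rho))) ∧
      (HasAverageAuD PM XM SM ZM avgM ∧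
        avgM = (1 + 2 * rho + 2 * rho ^ 2) / (lam * (1 + rho))) ∧
      (HasAverageAuD PD XD SD ZD avgD ∧
        avgD = (2 + 4 * rho + 3 * rho ^ 2) / (2 * lam * (1 + rho))) ∧
      avgD < avgU ∧ avgU < avgM := by
  have hrho0 : 0 < rho := hrho ▸ div_pos hlam hmu
  have := isProbabilityMeasure_uniformService hmu
  have : IsProbabilityMeasure (expMeasure mu) := isProbabilityMeasure_expMeasure hmu
  have : IsProbabilityMeasure (deterministicService mu) :=
    inferInstanceAs (IsProbabilityMeasure (Measure.dirac _))
  have kU := hU.hasAverageAuD hlam hnuU ((ae_mem_uniformService mu).mono fun y hy => hy.1)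
    (integrable_pow_uniformService hmu) (integral_id_uniformService hmu)
    (integral_sq_uniformService hmu)
  have kM := IsMG11M.hasAverageAuD (σ := expMeasure mu) (h := hM) hlam hnuM (ae_pos_expMeasure mu) (integrable_pow_expMeasure hmu)
    (integral_id_expMeasure hmu) (integral_sq_expMeasure hmu)
  have hDpos : ∀ᵐ y ∂(deterministicService mu), 0 < y := by
    rw [deterministicService, ae_dirac_iff measurableSet_Ioi]
    positivity
  have kD := hD.hasAverageAuD (m := 1 / mu) (v := (1 / mu) ^ 2) hlam hnuD hDpos
    (fun k => integrable_dirac (by simp)) (by simp [deterministicService])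
    (by simp [deterministicService])
  have hlt : ∀ v w : ℝ, v < w →
      (1 / mu * (1 / lam + 1 / mu) + (2 / lam ^ 2 + 2 * (1 / lam) * (1 / mu) + v) / 2) /
          (1 / lam + 1 / mu)
        < (1 / mu * (1 / lam + 1 / mu) + (2 / lam ^ 2 + 2 * (1 / lam) * (1 / mu) + w) / 2) /
          (1 / lam + 1 / mu) := fun v w h => by gcongr
  have hsq : 0 < 1 / mu ^ 2 := by positivity
  have e1 : (1 / mu) ^ 2 = 1 / mu ^ 2 := by ring
  have e2 : 4 / (3 * mu ^ 2) = 4 / 3 * (1 / mu ^ 2) := by field_simp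
  have e3 : 2 / mu ^ 2 = 2 * (1 / mu ^ 2) := by ring
  refine ⟨_, _, _, ⟨kU, ?_⟩, ⟨kM, ?_⟩, ⟨kD, ?_⟩, ?_, ?_⟩
  · subst hrho; field_simp; ring
  · subst hrho; field_simp; ring
  · subst hrho; field_simp; ring
  · exact hlt _ _ (by rw [e1, e2]; linarith)
  · exact hlt _ _ (by rw [e2, e3]; linarith)
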